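/- **Theorem 3.1.** Let $N\ge 1$, let $\Omega\subset\mathbb R^N$ be a bounded open set, $1\le p\le 2$, $\alpha\in\mathbb R$, and fix $0<R_0<\tfrac12$. For $f\in C_c^\infty(\Omega)$ put $$\|f\|_{\mathbb V^{p2,\alpha}(\Omega)}:=\sup\Big(\sum_j\Big(R_j^{N/p}\,|\log R_j|^{\alpha}\,\frac1{|B_j|}\int_{B_j}|f|\,dx\Big)^2\Big)^{1/2},$$ the supremum being taken over all collections $\{B_j\}$ of mutually disjoint open balls $B_j=B_{R_j}(x_j)\subset\Omega$ with radii $0<R_j\le R_0$. Let $\{f^\varepsilon\}\subset C_c^\infty(\Omega)$ be a family, whose members are supported in a common compact set $K\subset\Omega$, which is bounded in $\mathbb V^{p2,\alpha}(\Omega)$: $\sup_\varepsilon\|f^\varepsilon\|_{\mathbb V^{p2,\alpha}(\Omega)}<\infty$. If either (a) $p>\dfrac{2N}{N+2}$, or (b) $p=\dfrac{2N}{N+2}$ and $\alpha>\tfrac12$, then $\{f^\varepsilon\}$ (extended by zero) is precompact, i.e. has compact closure, in $H^{-1}_{\rm loc}(\mathbb R^N)$, the space of distributions $T$ with $\chi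 T\in H^{-1}(\mathbb R^N)=(H^1(\mathbb R^N))'$ for all $\chi\in C_c^\infty(\mathbb R^N)$, topologized by the seminorms $T\mapsto\|\chi T\|_{H^{-1}(\mathbb R^N)}$. -/

import Mathlib

open MeasureTheory Set TopologicalSpace
open scoped ENNReal NNReal Distributions

noncomputable section

namespace VSpace

/-- Euclidean space `ℝ^N`. -/
abbrev E (N : ℕ) : Type := EuclideanSpace ℝ (Fin N)

/-! ### The spaces `𝕍^{pq}(log 𝕍)^α` -/

/-- `𝓑` (a set of pairs (centre, radius)) is a collection of mutually disjoint balls contained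
in `Ω`, of radius at most `R₀`. Such a collection is automatically countable. -/
def IsBallPacking {N : ℕ} (Ω : Set (E N)) (R₀ : ℝ) (𝓑 : Set (E N × ℝ)) : Prop :=
  (∀ b ∈ 𝓑, 0 < b.2 ∧ b.2 ≤ R₀ ∧ Metric.ball b.1 b.2 ⊆ Ω) ∧
    𝓑.PairwiseDisjoint (fun b => Metric.ball b.1 b.2)

/-- The norm of `𝕍^{pq,α}(Ω) = 𝕍^{pq}(log 𝕍)^α(Ω)` (for a finite secondary index `q`): the supremum
over all collections `{B_j}` of disjoint balls in `Ω`, with radii `R_j ≤ R₀`, of the `ℓ^q` norm of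
`R_j^{N/p} |log R_j|^α ⨍_{B_j} |f|`. -/
def vNorm {N : ℕ} (p q α R₀ : ℝ) (Ω : Set (E N)) (f : E N → ℝ) : ℝ≥0∞ :=
  ⨆ (𝓑 : Set (E N × ℝ)) (_ : IsBallPacking Ω R₀ 𝓑),
    (∑' b : 𝓑, (ENNReal.ofReal (b.1.2 ^ ((N : ℝ) / p) * |Real.log b.1.2| ^ α) *
      ⨍⁻ x in Metric.ball b.1.1 b.1.2, ‖f x‖ₑ ∂volume) ^ q) ^ (1 / q)

/-! ### The Fréchet space `H^{-1}_loc(ℝ^N)` -/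

/-- Real test functions on `ℝ^N`, i.e. the space `C_c^∞(ℝ^N)`. -/
abbrev Test (N : ℕ) : Type := 𝓓((⊤ : Opens (E N)), ℝ)

/-- The `H^1(ℝ^N)` norm of a test function. -/
def h1Norm {N : ℕ} (φ : Test N) : ℝ :=
  √(∫ x, (φ x ^ 2 + ‖fderiv ℝ φ x‖ ^ 2))

/-- The pointwise product `χ φ` of test functions. -/
def mulTest {N : ℕ} (χ φ : Test N) : Test N where
  toFun x := χ x * φ x
  contDiff' := χ.contDiff.mul φ.contDiff
  hasCompactSupport' := φ.hasCompactSupport.mul_left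
  tsupport_subset' := fun _ _ => trivial

/-- A functional `L` on test functions belongs to `H^{-1}(ℝ^N)`, the dual of `H^1(ℝ^N)`
(in which test functions are dense). -/
def MemHNegOne {N : ℕ} (L : Test N → ℝ) : Prop :=
  ∃ C : ℝ, ∀ φ : Test N, |L φ| ≤ C * h1Norm φ

/-- The `H^{-1}(ℝ^N)` norm, `sup {|L φ| : ‖φ‖_{H^1} ≤ 1}`. -/
def hNegOneNorm {N : ℕ} (L : Test N → ℝ) : ℝ :=
  ⨆ φ : {φ : Test N // h1Norm φ ≤ 1}, |L φ.1|

lemma MemHNegOne.bddAbove {N : ℕ} {L : Test N → ℝ} (h : MemHNegOne L) :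
    BddAbove (range fun φ : {φ : Test N // h1Norm φ ≤ 1} => |L φ.1|) := by
  obtain ⟨C, hC⟩ := h
  refine ⟨|C|, ?_⟩
  rintro _ ⟨φ, rfl⟩
  refine (hC φ.1).trans ((le_abs_self _).trans ?_)
  rw [abs_mul]
  have h0 : 0 ≤ h1Norm φ.1 := Real.sqrt_nonneg _
  have h1 := φ.2
  rw [abs_of_nonneg h0]
  nlinarith [abs_nonneg C]

/-- The distributions `T` with `χ T ∈ H^{-1}(ℝ^N)` for all `χ ∈ C_c^∞(ℝ^N)`,
where `(χ T)(φ) = T(χ φ)`. -/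
def hNegOneLocSubmodule (N : ℕ) : Submodule ℝ (𝓓'((⊤ : Opens (E N)), ℝ)) where
  carrier := {T | ∀ χ : Test N, MemHNegOne fun φ => T (mulTest χ φ)}
  zero_mem' := fun χ => ⟨0, fun φ => by simp⟩
  add_mem' := by
    intro S T hS hT χ
    obtain ⟨C, hC⟩ := hS χ
    obtain ⟨D, hD⟩ := hT χ
    refine ⟨C + D, fun φ => ?_⟩
    have h := abs_add_le (S (mulTest χ φ)) (T (mulTest χ φ))
    have h1 := hC φ
    have h2 := hD φ
    change |S (mulTest χ φ) + T (mulTest χ φ)| ≤ _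
    simp only at h1 h2
    linarith
  smul_mem' := by
    intro c T hT χ
    obtain ⟨C, hC⟩ := hT χ
    refine ⟨|c| * C, fun φ => ?_⟩
    change |c * T (mulTest χ φ)| ≤ _
    rw [abs_mul, mul_assoc]
    exact mul_le_mul_of_nonneg_left (hC φ) (abs_nonneg c)

/-- The space `H^{-1}_loc(ℝ^N)`. -/
def HNegOneLoc (N : ℕ) : Type := hNegOneLocSubmodule N

instance (N : ℕ) : AddCommGroup (HNegOneLoc N) :=
  inferInstanceAs (AddCommGroup (hNegOneLocSubmodule N))

instance (N : ℕ) : Module ℝ (HNegOneLoc N) :=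
  inferInstanceAs (Module ℝ (hNegOneLocSubmodule N))

/-- The seminorms `T ↦ ‖χ T‖_{H^{-1}}`, `χ ∈ C_c^∞(ℝ^N)`. -/
def hNegOneLocSeminorm (N : ℕ) : SeminormFamily ℝ (HNegOneLoc N) (Test N) := fun χ =>
  Seminorm.of (fun T => hNegOneNorm fun φ => T.1 (mulTest χ φ))
    (by
      intro S T
      have hne : Nonempty {φ : Test N // h1Norm φ ≤ 1} := ⟨⟨0, by simp [h1Norm]⟩⟩
      refine ciSup_le fun φ => ?_
      change |S.1 (mulTest χ φ.1) + T.1 (mulTest χ φ.1)| ≤ _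
      exact (abs_add_le _ _).trans
        (add_le_add (le_ciSup (S.2 χ).bddAbove φ) (le_ciSup (T.2 χ).bddAbove φ)))
    (by
      intro c T
      simp only [hNegOneNorm, Real.norm_eq_abs]
      rw [Real.mul_iSup_of_nonneg (abs_nonneg c)]
      refine iSup_congr fun φ => ?_
      change |c * T.1 (mulTest χ φ.1)| = _
      rw [abs_mul])

/-- `H^{-1}_loc(ℝ^N)` carries the locally convex topology given by the seminorms
`T ↦ ‖χ T‖_{H^{-1}}`. -/
instance (N : ℕ) : TopologicalSpace (HNegOneLoc N) :=
  (hNegOneLocSeminorm N).moduleFilterBasis.topology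

lemma withSeminorms_hNegOneLoc (N : ℕ) : WithSeminorms (hNegOneLocSeminorm N) := ⟨rfl⟩

/-- The distribution `φ ↦ ∫ φ f` on `ℝ^N` given by a function `f ∈ C_c^∞(Ω)`
(extended by zero). -/
def toDistribution {N : ℕ} {Ω : Opens (E N)} (f : 𝓓(Ω, ℝ)) : 𝓓'((⊤ : Opens (E N)), ℝ) :=
  TestFunction.integralAgainstBilinCLM (ContinuousLinearMap.mul ℝ ℝ) volume f

lemma toDistribution_apply {N : ℕ} {Ω : Opens (E N)} (f : 𝓓(Ω, ℝ)) (φ : Test N) :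
    toDistribution f φ = ∫ x, φ x * f x := by
  have h : LocallyIntegrableOn (f : E N → ℝ) ((⊤ : Opens (E N)) : Set (E N)) volume :=
    f.continuous.locallyIntegrable.locallyIntegrableOn _
  exact TestFunction.integralAgainstBilinCLM_eq_integral h

lemma l2Norm_le_aux {N : ℕ} {φ : E N → ℝ} (h1 : ContDiff ℝ 1 φ) (h2 : HasCompactSupport φ) :
    (∫ x, ‖φ x‖ ^ (2 : ℝ)) ^ (1 / 2 : ℝ) ≤ √(∫ x, (φ x ^ 2 + ‖fderiv ℝ φ x‖ ^ 2)) := by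
  have hs1 : HasCompactSupport fun x => φ x ^ 2 :=
    h2.comp_left (g := fun t : ℝ => t ^ 2) (by norm_num)
  have hs2 : HasCompactSupport fun x => ‖fderiv ℝ φ x‖ ^ 2 :=
    (h2.fderiv (𝕜 := ℝ)).comp_left (g := fun t : E N →L[ℝ] ℝ => ‖t‖ ^ 2) (by simp)
  have hi1 : Integrable (fun x => φ x ^ 2) (volume : Measure (E N)) :=
    (h1.continuous.pow 2).integrable_of_hasCompactSupport hs1
  have hc : Continuous fun x => fderiv ℝ φ x := h1.continuous_fderiv (by simp)
  have hi2 : Integrable (fun x => ‖fderiv ℝ φ x‖ ^ 2) (volume : Measure (E N)) :=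
    (hc.norm.pow 2).integrable_of_hasCompactSupport hs2
  rw [Real.sqrt_eq_rpow]
  refine Real.rpow_le_rpow (integral_nonneg fun x => by positivity) ?_ (by norm_num)
  refine integral_mono (by simpa using hi1) (hi1.add hi2) fun x => ?_
  simp only [Real.rpow_two, Real.norm_eq_abs, sq_abs]
  nlinarith [sq_nonneg ‖fderiv ℝ φ x‖]

lemma l2Norm_le_h1Norm {N : ℕ} (φ : Test N) :
    (∫ x, ‖φ x‖ ^ (2 : ℝ)) ^ (1 / 2 : ℝ) ≤ h1Norm φ :=
  l2Norm_le_aux (φ.contDiff.of_le (by exact_mod_cast le_top)) φ.hasCompactSupport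

lemma abs_integral_mul_le {N : ℕ} {g φ : E N → ℝ} (hg : Continuous g) (hg' : HasCompactSupport g)
    (hφ : Continuous φ) (hφ' : HasCompactSupport φ) :
    |∫ x, g x * φ x| ≤
      (∫ x, ‖g x‖ ^ (2 : ℝ)) ^ (1 / 2 : ℝ) * (∫ x, ‖φ x‖ ^ (2 : ℝ)) ^ (1 / 2 : ℝ) := by
  refine (norm_integral_le_integral_norm (fun x => g x * φ x)).trans ?_
  simp only [norm_mul]
  exact integral_mul_norm_le_Lp_mul_Lq (μ := volume) Real.HolderConjugate.two_two
    (hg.memLp_of_hasCompactSupport hg') (hφ.memLp_of_hasCompactSupport hφ')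

lemma memHNegOne_toDistribution {N : ℕ} {Ω : Opens (E N)} (f : 𝓓(Ω, ℝ)) (χ : Test N) :
    MemHNegOne fun φ => toDistribution f (mulTest χ φ) := by
  refine ⟨(∫ x, ‖χ x * f x‖ ^ (2 : ℝ)) ^ (1 / 2 : ℝ), fun φ => ?_⟩
  have h := abs_integral_mul_le (g := fun x => χ x * f x) (φ := fun x => φ x)
    (χ.continuous.mul f.continuous) χ.hasCompactSupport.mul_right φ.continuous φ.hasCompactSupport
  have h' : toDistribution f (mulTest χ φ) = ∫ x, (χ x * f x) * φ x := by
    rw [toDistribution_apply]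
    refine integral_congr_ae (Filter.Eventually.of_forall fun x => ?_)
    exact mul_right_comm (χ x) (φ x) (f x)
  simp only [h']
  exact h.trans (mul_le_mul_of_nonneg_left (l2Norm_le_h1Norm φ) (by positivity))

/-- A function `f ∈ C_c^∞(Ω)` as an element of `H^{-1}_loc(ℝ^N)`. -/
def toHNegOneLoc {N : ℕ} {Ω : Opens (E N)} (f : 𝓓(Ω, ℝ)) : HNegOneLoc N :=
  ⟨toDistribution f, memHNegOne_toDistribution f⟩

end VSpace

end

/-!
The proof is dyadic and elementary. Let `Q` range over the cubes of generation `k`, whose diameter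
is below `2⁻ᵏ`, and put `A_k = ∑_Q (∫_Q |f|)²`. The cubes split into finitely many classes for which
the balls of radius `2⁻ᵏ` at their corners are disjoint, so the norm of `f` bounds `A_k`:
up to constants `2^{-2k} |Q|⁻¹ A_k ≤ 2^{-kγ} k^{-2α}`, where `γ = N + 2 - 2N/p`
(`rad_sq_mul_cubeEnergy_le`, `decay_eq`). This is summable exactly when `γ > 0`, or `γ = 0` and
`α > 1/2`: the two alternatives of the hypothesis (`summable_decay`).

For a test function `φ`, telescoping its averages over the cubes containing `x` and applying the
Poincaré inequality to each step gives `|φ - φ_k| ≤ C I_k(|∇φ|)`, where `φ_k` takes on each cube of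
generation `k` the average of `φ`, and `I_k` is a dyadic potential of order one, summed over the
generations from `k` on (`enorm_sub_cubeAvg_le`). As `I_k` is self-adjoint,
`|∫ f (φ - φ_k)| ≤ C ‖∇φ‖₂ ‖I_k |f|‖₂`, and since the cubes are nested,
`‖I_k |f|‖₂² ≤ 4 ∑_{l ≥ k} 2^{-2l} |Q_l|⁻¹ A_l` (`lintegral_potential_sq_le`). Summing squares
over the generations, rather than the generations themselves, is what allows `α > 1/2` in place of
`α > 1`.

So, uniformly over the family, `f` is close in `H⁻¹` to the functional
`φ ↦ ∫ f φ_k = ∑_Q (∫_Q f) ⨍_Q φ`, which ranges over a bounded subset of a space of finite dimension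
(`norm_pairing_sub_le`). Hence the family is totally bounded in `H⁻¹`, the dual of `H¹`, which is
complete and maps continuously into `H⁻¹_loc` (`continuous_dualToHNegOneLoc`).
-/

namespace VSpace

/-! ### A Poincaré inequality on convex sets -/

section Poincare

variable {F : Type*} [NormedAddCommGroup F] [NormedSpace ℝ F]

/-- The fundamental theorem of calculus on the half of the segment `[y, x]` nearest to `x`. Only
this half is used because there the map `x ↦ y + t • (x - y)` contracts by a factor `t ≥ 1/2`, so
that the change of variables costs a bounded factor. -/
theorem enorm_sub_midpoint_le {φ : F → ℝ} (hφ : ContDiff ℝ 1 φ) (x y : F) :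
    ‖φ x - φ (y + (1 / 2 : ℝ) • (x - y))‖ₑ ≤
      ‖x - y‖ₑ * ∫⁻ t in Ioc (1 / 2 : ℝ) 1, ‖fderiv ℝ φ (y + t • (x - y))‖ₑ := by
  have hd : ∀ t : ℝ, HasDerivAt (fun t : ℝ => φ (y + t • (x - y)))
      (fderiv ℝ φ (y + t • (x - y)) (x - y)) t := by
    intro t
    have h1 : HasDerivAt (fun t : ℝ => y + t • (x - y)) (x - y) t := by
      simpa using ((hasDerivAt_id t).smul_const (x - y)).const_add y
    exact ((hφ.differentiable (by simp)) _).hasFDerivAt.comp_hasDerivAt t h1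
  have hline : Continuous fun t : ℝ => y + t • (x - y) := by fun_prop
  have hgc : Continuous fun t : ℝ => fderiv ℝ φ (y + t • (x - y)) :=
    (hφ.continuous_fderiv (by simp)).comp hline
  have hc : Continuous fun t : ℝ => fderiv ℝ φ (y + t • (x - y)) (x - y) :=
    hgc.clm_apply continuous_const
  have hftc := intervalIntegral.integral_eq_sub_of_hasDerivAt (a := (1 / 2 : ℝ)) (b := 1)
    (fun t _ => hd t) (hc.intervalIntegrable _ _)
  have hx : φ x = φ (y + (1 : ℝ) • (x - y)) := by simp
  rw [hx, ← hftc, intervalIntegral.integral_of_le (by norm_num)]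
  refine (enorm_integral_le_lintegral_enorm _).trans ?_
  rw [← lintegral_const_mul' _ _ (by simp)]
  refine lintegral_mono fun t => ?_
  rw [mul_comm]
  exact ContinuousLinearMap.le_opENorm _ _

variable [MeasurableSpace F] [BorelSpace F] [FiniteDimensional ℝ F] (μ : Measure F)
  [μ.IsAddHaarMeasure]

/-- A homothety of ratio `t > 1/2` with centre in a convex set `Q` maps `Q` into itself, with
Jacobian at least `2⁻ⁿ`. -/
theorem lintegral_contraction_le {Q : Set F} (hQ : MeasurableSet Q) (hconv : Convex ℝ Q)
    {g : F → ℝ≥0∞} (hg : Measurable g) {y : F} (hy : y ∈ Q) {t : ℝ} (ht : t ∈ Ioc (1 / 2 : ℝ) 1) :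
    ∫⁻ x in Q, g (y + t • (x - y)) ∂μ ≤ 2 ^ Module.finrank ℝ F * ∫⁻ x in Q, g x ∂μ := by
  have htpos : 0 < t := lt_trans (by norm_num) ht.1
  have ht0 : t ≠ 0 := htpos.ne'
  have hcomp : ∀ x : F, y + t • (x - y) = t • x + (y - t • y) := fun x => by
    rw [smul_sub]; abel
  calc ∫⁻ x in Q, g (y + t • (x - y)) ∂μ
      = ∫⁻ x, Q.indicator (fun x => g (y + t • (x - y))) x ∂μ := (lintegral_indicator hQ _).symm
    _ ≤ ∫⁻ x, Q.indicator g (t • x + (y - t • y)) ∂μ := by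
        refine lintegral_mono fun x => ?_
        by_cases hx : x ∈ Q
        · have hmem : t • x + (y - t • y) ∈ Q := by
            have := hconv hx hy htpos.le (sub_nonneg.2 ht.2) (by ring)
            rwa [sub_smul, one_smul] at this
          rw [indicator_of_mem hx, indicator_of_mem hmem, hcomp]
        · simp [hx]
    _ = ∫⁻ x, Q.indicator g (x + (y - t • y)) ∂(μ.map (t • ·)) := by
        rw [lintegral_map]
        · exact (hg.indicator hQ).comp (measurable_id.add_const _)
        · exact measurable_const_smul t
    _ = ENNReal.ofReal |(t ^ Module.finrank ℝ F)⁻¹| * ∫⁻ x in Q, g x ∂μ := by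
        rw [Measure.map_addHaar_smul μ ht0, lintegral_smul_measure,
          lintegral_add_right_eq_self (Q.indicator g), lintegral_indicator hQ, smul_eq_mul]
    _ ≤ _ := by
        gcongr
        rw [abs_of_pos (by positivity), ← inv_pow]
        have h2 : t⁻¹ ≤ 2 := by
          rw [inv_le_comm₀ htpos two_pos]; have := ht.1; norm_num at this ⊢; exact this.le
        calc ENNReal.ofReal (t⁻¹ ^ Module.finrank ℝ F)
            ≤ ENNReal.ofReal (2 ^ Module.finrank ℝ F) := by
              apply ENNReal.ofReal_le_ofReal; gcongr
          _ = _ := by rw [ENNReal.ofReal_pow two_pos.le]; simp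

/-- A Poincaré inequality in `L¹` on a convex set, for the double integral of the oscillation. -/
theorem lintegral_lintegral_enorm_sub_le {Q : Set F} (hQ : MeasurableSet Q) (hconv : Convex ℝ Q)
    {d : ℝ≥0∞} (hd : ∀ x ∈ Q, ∀ y ∈ Q, ‖x - y‖ₑ ≤ d) (hd' : d ≠ ∞) {φ : F → ℝ}
    (hφ : ContDiff ℝ 1 φ) :
    ∫⁻ y in Q, ∫⁻ x in Q, ‖φ x - φ y‖ₑ ∂μ ∂μ ≤
      2 ^ Module.finrank ℝ F * d * μ Q * ∫⁻ x in Q, ‖fderiv ℝ φ x‖ₑ ∂μ := by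
  set I := ∫⁻ x in Q, ‖fderiv ℝ φ x‖ₑ ∂μ
  have hφc : Continuous φ := hφ.continuous
  have hgc : Continuous fun x => ‖fderiv ℝ φ x‖ₑ := (hφ.continuous_fderiv (by simp)).enorm
  have hmc : Continuous fun z : F × F => ‖φ z.1 - φ (z.2 + (1 / 2 : ℝ) • (z.1 - z.2))‖ₑ := by
    fun_prop
  -- By the midpoint, `|φ x - φ y|` splits into two halves that are exchanged by `x ↔ y`.
  have hhalf : ∫⁻ y in Q, ∫⁻ x in Q, ‖φ x - φ (y + (1 / 2 : ℝ) • (x - y))‖ₑ ∂μ ∂μ ≤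
      2 ^ Module.finrank ℝ F * d * μ Q * I * ENNReal.ofReal (1 / 2) := by
    calc ∫⁻ y in Q, ∫⁻ x in Q, ‖φ x - φ (y + (1 / 2 : ℝ) • (x - y))‖ₑ ∂μ ∂μ
        ≤ ∫⁻ y in Q, d * (2 ^ Module.finrank ℝ F * I * ENNReal.ofReal (1 / 2)) ∂μ := by
          refine setLIntegral_mono' hQ fun y hy => ?_
          calc ∫⁻ x in Q, ‖φ x - φ (y + (1 / 2 : ℝ) • (x - y))‖ₑ ∂μ
              ≤ ∫⁻ x in Q, d * (∫⁻ t in Ioc (1 / 2 : ℝ) 1,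
                  ‖fderiv ℝ φ (y + t • (x - y))‖ₑ) ∂μ := by
                refine setLIntegral_mono' hQ fun x hx => ?_
                refine (enorm_sub_midpoint_le hφ x y).trans ?_
                gcongr
                exact hd x hx y hy
            _ = d * ∫⁻ t in Ioc (1 / 2 : ℝ) 1, ∫⁻ x in Q,
                  ‖fderiv ℝ φ (y + t • (x - y))‖ₑ ∂μ := by
                rw [lintegral_const_mul' _ _ hd', lintegral_lintegral_swap]
                apply Measurable.aemeasurable
                exact Continuous.measurable (hgc.comp
                  (by fun_prop : Continuous fun z : F × ℝ => y + z.2 • (z.1 - y)))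
            _ ≤ d * ∫⁻ t in Ioc (1 / 2 : ℝ) 1, 2 ^ Module.finrank ℝ F * I := by
                gcongr 1
                exact setLIntegral_mono' measurableSet_Ioc fun t ht =>
                  lintegral_contraction_le μ hQ hconv hgc.measurable hy ht
            _ = _ := by
                rw [setLIntegral_const, Real.volume_Ioc]; norm_num
      _ = _ := by rw [setLIntegral_const]; ring
  calc ∫⁻ y in Q, ∫⁻ x in Q, ‖φ x - φ y‖ₑ ∂μ ∂μ
      ≤ ∫⁻ y in Q, ∫⁻ x in Q, (‖φ x - φ (y + (1 / 2 : ℝ) • (x - y))‖ₑ +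
          ‖φ y - φ (x + (1 / 2 : ℝ) • (y - x))‖ₑ) ∂μ ∂μ := by
        refine lintegral_mono fun y => lintegral_mono fun x => ?_
        have hmid : x + (1 / 2 : ℝ) • (y - x) = y + (1 / 2 : ℝ) • (x - y) := by module
        rw [hmid]
        refine le_trans (le_of_eq ?_) (enorm_sub_le)
        congr 1; ring
    _ = ∫⁻ y in Q, ∫⁻ x in Q, ‖φ x - φ (y + (1 / 2 : ℝ) • (x - y))‖ₑ ∂μ ∂μ +
          ∫⁻ y in Q, ∫⁻ x in Q, ‖φ x - φ (y + (1 / 2 : ℝ) • (x - y))‖ₑ ∂μ ∂μ := by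
        have h1 : ∀ y, ∫⁻ x in Q, (‖φ x - φ (y + (1 / 2 : ℝ) • (x - y))‖ₑ +
            ‖φ y - φ (x + (1 / 2 : ℝ) • (y - x))‖ₑ) ∂μ =
            ∫⁻ x in Q, ‖φ x - φ (y + (1 / 2 : ℝ) • (x - y))‖ₑ ∂μ +
            ∫⁻ x in Q, ‖φ y - φ (x + (1 / 2 : ℝ) • (y - x))‖ₑ ∂μ := fun y =>
          lintegral_add_left (Continuous.measurable (by fun_prop)) _
        simp_rw [h1]
        rw [lintegral_add_left]
        · congr 1
          rw [lintegral_lintegral_swap]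
          exact (hmc.measurable).aemeasurable
        · exact Measurable.lintegral_prod_right (hmc.comp continuous_swap).measurable
    _ ≤ _ := add_le_add hhalf hhalf
    _ = 2 ^ Module.finrank ℝ F * d * μ Q * I *
          (ENNReal.ofReal (1 / 2) + ENNReal.ofReal (1 / 2)) := by ring
    _ = _ := by
        rw [← ENNReal.ofReal_add (by norm_num) (by norm_num)]; norm_num

/-- The averages of `φ` over a convex set and over a subset of it differ by at most a multiple of
`d ∫_Q |∇φ| / |P|`, where `d` bounds the diameter. -/
theorem enorm_average_sub_average_le {P Q : Set F} (hQ : MeasurableSet Q)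
    (hPQ : P ⊆ Q) (hconv : Convex ℝ Q) (hP0 : μ P ≠ 0) (hQtop : μ Q ≠ ∞)
    {d : ℝ≥0∞} (hd : ∀ x ∈ Q, ∀ y ∈ Q, ‖x - y‖ₑ ≤ d) (hd' : d ≠ ∞) {φ : F → ℝ}
    (hφ : ContDiff ℝ 1 φ) (hφs : HasCompactSupport φ) :
    ‖(⨍ x in P, φ x ∂μ) - ⨍ x in Q, φ x ∂μ‖ₑ ≤
      2 ^ Module.finrank ℝ F * d * (μ P)⁻¹ * ∫⁻ x in Q, ‖fderiv ℝ φ x‖ₑ ∂μ := by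
  have hPtop : μ P ≠ ∞ := ne_top_of_le_ne_top hQtop (measure_mono hPQ)
  have hQ0 : μ Q ≠ 0 := fun h => hP0 (measure_mono_null hPQ h)
  have hint : Integrable φ μ := hφ.continuous.integrable_of_hasCompactSupport hφs
  set cP := ⨍ x in P, φ x ∂μ
  set cQ := ⨍ x in Q, φ x ∂μ
  have hint' : ∀ (A : Set F) (_ : μ A ≠ ∞) (c : ℝ), IntegrableOn (fun x => φ x - c) A μ :=
    fun A hA c => hint.integrableOn.sub (integrableOn_const hA)
  have hdev : ∀ (A : Set F) (_ : μ A ≠ 0) (_ : μ A ≠ ∞) (c : ℝ),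
      μ A * ‖(⨍ x in A, φ x ∂μ) - c‖ₑ ≤ ∫⁻ x in A, ‖φ x - c‖ₑ ∂μ := by
    intro A hA0 hA c
    have h1 : (∫ x in A, (φ x - c) ∂μ) = μ.real A * ((⨍ x in A, φ x ∂μ) - c) := by
      rw [integral_sub hint.integrableOn (integrableOn_const hA), setAverage_eq,
        setIntegral_const, smul_eq_mul, smul_eq_mul, mul_sub, ← mul_assoc, mul_inv_cancel₀,
        one_mul]
      exact (ENNReal.toReal_ne_zero.2 ⟨hA0, hA⟩)
    have h2 := enorm_integral_le_lintegral_enorm (μ := μ.restrict A) fun x => φ x - c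
    rw [h1, enorm_mul] at h2
    refine le_trans (le_of_eq ?_) h2
    congr 1
    rw [Measure.real, Real.enorm_of_nonneg ENNReal.toReal_nonneg, ENNReal.ofReal_toReal hA]
  have key : μ P * μ Q * ‖cP - cQ‖ₑ ≤
      2 ^ Module.finrank ℝ F * d * μ Q * ∫⁻ x in Q, ‖fderiv ℝ φ x‖ₑ ∂μ := by
    calc μ P * μ Q * ‖cP - cQ‖ₑ = μ Q * (μ P * ‖cP - cQ‖ₑ) := by ring
      _ ≤ μ Q * ∫⁻ x in P, ‖φ x - cQ‖ₑ ∂μ := by gcongr; exact hdev P hP0 hPtop cQ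
      _ ≤ μ Q * ∫⁻ x in Q, ‖φ x - cQ‖ₑ ∂μ := by gcongr
      _ = ∫⁻ y in Q, μ Q * ‖cQ - φ y‖ₑ ∂μ := by
          rw [lintegral_const_mul' _ _ hQtop]
          simp_rw [enorm_sub_rev cQ]
      _ ≤ ∫⁻ y in Q, ∫⁻ x in Q, ‖φ x - φ y‖ₑ ∂μ ∂μ :=
          lintegral_mono fun y => hdev Q hQ0 hQtop (φ y)
      _ ≤ _ := lintegral_lintegral_enorm_sub_le μ hQ hconv hd hd' hφ
  calc ‖cP - cQ‖ₑ = (μ P * (μ P)⁻¹) * (μ Q * (μ Q)⁻¹) * ‖cP - cQ‖ₑ := by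
        rw [ENNReal.mul_inv_cancel hP0 hPtop, ENNReal.mul_inv_cancel hQ0 hQtop]; simp
    _ = (μ P)⁻¹ * (μ Q)⁻¹ * (μ P * μ Q * ‖cP - cQ‖ₑ) := by ring
    _ ≤ (μ P)⁻¹ * (μ Q)⁻¹ *
          (2 ^ Module.finrank ℝ F * d * μ Q * ∫⁻ x in Q, ‖fderiv ℝ φ x‖ₑ ∂μ) := by gcongr
    _ = (μ Q * (μ Q)⁻¹) * (2 ^ Module.finrank ℝ F * d * (μ P)⁻¹ *
          ∫⁻ x in Q, ‖fderiv ℝ φ x‖ₑ ∂μ) := by ring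
    _ = _ := by rw [ENNReal.mul_inv_cancel hQ0 hQtop, one_mul]

end Poincare

/-! ### Nested cubes and separated balls -/

/-- The dyadic radius `2⁻ᵏ`. -/
noncomputable def rad (k : ℕ) : ℝ := (2⁻¹ : ℝ) ^ k

theorem rad_pos (k : ℕ) : 0 < rad k := by unfold rad; positivity

/-- The side `2⁻ᵏ / (2N)` of the cubes of generation `k`. The factor `2N` makes the diameter of a
cube smaller than `2⁻ᵏ`, so that a ball of radius `2⁻ᵏ` around any of its points covers it. -/
noncomputable def side (N k : ℕ) : ℝ := rad k / (2 * N)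

theorem side_pos {N : ℕ} (hN : 1 ≤ N) (k : ℕ) : 0 < side N k := by
  have : (0 : ℝ) < N := by exact_mod_cast hN
  have := rad_pos k
  unfold side; positivity

/-- The index, in `ℤ^N`, of the half-open cube of generation `k` that contains `x`. -/
noncomputable def cubeIndex {N : ℕ} (k : ℕ) (x : E N) : Fin N → ℤ := fun i => ⌊x i / side N k⌋

/-- The half-open cube of generation `k` with index `z`. Being the fibres of `cubeIndex k`, the
cubes of one generation partition the space. -/
noncomputable def cube {N : ℕ} (k : ℕ) (z : Fin N → ℤ) : Set (E N) := {x | cubeIndex k x = z}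

theorem mem_cube {N : ℕ} {k : ℕ} {z : Fin N → ℤ} {x : E N} :
    x ∈ cube k z ↔ cubeIndex k x = z := Iff.rfl

theorem measurable_cubeIndex {N : ℕ} (k : ℕ) : Measurable (cubeIndex k : E N → Fin N → ℤ) := by
  refine measurable_pi_lambda _ fun i => Int.measurable_floor.comp ?_
  exact Measurable.div_const (Continuous.measurable (by fun_prop)) _

theorem measurableSet_cube {N : ℕ} (k : ℕ) (z : Fin N → ℤ) : MeasurableSet (cube (N := N) k z) :=
  measurable_cubeIndex k (measurableSet_singleton z)

theorem side_succ (N k : ℕ) : side N k = side N (k + 1) * 2 := by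
  unfold side rad; rw [pow_succ]; ring

/-- The cubes are nested: those of generation `l` refine those of generation `k ≤ l`. -/
theorem cubeIndex_eq_of_le {N : ℕ} {k l : ℕ} (hkl : k ≤ l) {x y : E N}
    (h : cubeIndex l x = cubeIndex l y) : cubeIndex k x = cubeIndex k y := by
  induction l, hkl using Nat.le_induction with
  | base => exact h
  | succ l _ ih =>
    refine ih (funext fun i => ?_)
    have hdiv : ∀ x : E N, cubeIndex l x i = cubeIndex (l + 1) x i / 2 := fun x => by
      have := Int.floor_div_natCast (x i / side N (l + 1)) 2
      simp only [cubeIndex, side_succ N l, ← div_div]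
      exact_mod_cast this
    rw [hdiv, hdiv, h]

theorem mem_cube_iff {N : ℕ} (hN : 1 ≤ N) {k : ℕ} {z : Fin N → ℤ} {x : E N} :
    x ∈ cube k z ↔ ∀ i, x i ∈ Ico (z i * side N k) ((z i + 1) * side N k) := by
  have hs := side_pos hN k
  rw [mem_cube, funext_iff]
  refine forall_congr' fun i => ?_
  rw [cubeIndex, Int.floor_eq_iff, le_div_iff₀ hs, div_lt_iff₀ hs, mem_Ico]

theorem cube_eq_preimage {N : ℕ} (hN : 1 ≤ N) (k : ℕ) (z : Fin N → ℤ) :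
    cube k z = WithLp.ofLp ⁻¹'
      (univ.pi fun i => Ico (z i * side N k) ((z i + 1) * side N k)) := by
  ext x
  rw [mem_cube_iff hN]
  simp

theorem convex_cube {N : ℕ} (hN : 1 ≤ N) (k : ℕ) (z : Fin N → ℤ) :
    Convex ℝ (cube (N := N) k z) := by
  intro x hx y hy a b ha hb hab
  rw [mem_cube_iff hN] at *
  intro i
  exact convex_Ico _ _ (hx i) (hy i) ha hb hab

theorem volume_cube {N : ℕ} (hN : 1 ≤ N) (k : ℕ) (z : Fin N → ℤ) :
    volume (cube (N := N) k z) = ENNReal.ofReal (side N k ^ N) := by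
  rw [cube_eq_preimage hN,
    (PiLp.volume_preserving_ofLp (Fin N)).measure_preimage
      (MeasurableSet.univ_pi fun _ => measurableSet_Ico).nullMeasurableSet, volume_pi_pi]
  have : ∀ i, volume (Ico (z i * side N k) ((z i + 1) * side N k)) = ENNReal.ofReal (side N k) :=
    fun i => by rw [Real.volume_Ico]; congr 1; ring
  simp [this, ENNReal.ofReal_pow (side_pos hN k).le]

theorem norm_lt_of_abs_lt {N : ℕ} (hN : 1 ≤ N) {k : ℕ} {v : E N} (h : ∀ i, |v i| ≤ side N k) :
    ‖v‖ < rad k := by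
  have hr := rad_pos k
  have hN' : (1 : ℝ) ≤ N := by exact_mod_cast hN
  have hs := side_pos hN k
  rw [EuclideanSpace.norm_eq, Real.sqrt_lt' hr]
  calc ∑ i, ‖v i‖ ^ 2 ≤ ∑ _i : Fin N, side N k ^ 2 := by
        refine Finset.sum_le_sum fun i _ => ?_
        rw [Real.norm_eq_abs]
        exact pow_le_pow_left₀ (abs_nonneg _) (h i) 2
    _ = N * side N k ^ 2 := by simp
    _ < (2 * N * side N k) ^ 2 := by nlinarith [mul_pos hs hs]
    _ = rad k ^ 2 := by unfold side; field_simp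

theorem norm_sub_lt_of_mem_cube {N : ℕ} (hN : 1 ≤ N) {k : ℕ} {z : Fin N → ℤ} {x y : E N}
    (hx : x ∈ cube k z) (hy : y ∈ cube k z) : ‖x - y‖ < rad k := by
  refine norm_lt_of_abs_lt hN fun i => ?_
  have h1 := (mem_cube_iff hN).1 hx i
  have h2 := (mem_cube_iff hN).1 hy i
  rw [PiLp.sub_apply, abs_le]
  constructor <;> nlinarith [h1.1, h1.2, h2.1, h2.2]

/-- The lower corner of a cube. -/
noncomputable def corner {N : ℕ} (k : ℕ) (z : Fin N → ℤ) : E N :=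
  WithLp.toLp 2 fun i => z i * side N k

theorem corner_mem_cube {N : ℕ} (hN : 1 ≤ N) (k : ℕ) (z : Fin N → ℤ) :
    corner k z ∈ cube k z := by
  have hs := side_pos hN k
  rw [mem_cube_iff hN]
  intro i
  simp only [corner, mem_Ico, le_refl, true_and]
  nlinarith

theorem cube_subset_ball {N : ℕ} (hN : 1 ≤ N) (k : ℕ) (z : Fin N → ℤ) :
    cube k z ⊆ Metric.ball (corner k z) (rad k) := fun x hx => by
  rw [Metric.mem_ball, dist_eq_norm]
  exact norm_sub_lt_of_mem_cube hN hx (corner_mem_cube hN k z)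

/-- The balls of radius `2⁻ᵏ` at the corners of two cubes whose indices agree modulo `4N` are
disjoint. So the cubes of one generation fall into `(4N)^N` classes, each of which is covered cube
by cube by a packing of balls. -/
theorem disjoint_ball_corner {N : ℕ} {k : ℕ} {z w : Fin N → ℤ} (hzw : z ≠ w)
    (h : ∀ i, (z i : ZMod (4 * N)) = w i) :
    Disjoint (Metric.ball (corner (N := N) k z) (rad k)) (Metric.ball (corner k w) (rad k)) := by
  obtain ⟨i, hi⟩ := Function.ne_iff.1 hzw
  have hN : 1 ≤ N := by have := i.2; omega
  refine Metric.ball_disjoint_ball ?_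
  have hdvd : (4 * N : ℤ) ∣ z i - w i := by
    have := (ZMod.intCast_eq_intCast_iff_dvd_sub (w i) (z i) (4 * N)).1 (h i).symm
    exact_mod_cast this
  have hge : (4 * N : ℤ) ≤ |z i - w i| :=
    Int.le_of_dvd (abs_pos.2 (sub_ne_zero.2 hi)) ((dvd_abs _ _).2 hdvd)
  have hge' : (4 * N : ℝ) ≤ |(z i : ℝ) - w i| := by exact_mod_cast hge
  have hs := side_pos hN k
  have hN' : (0 : ℝ) < N := by exact_mod_cast hN
  calc rad k + rad k = 4 * N * side N k := by unfold side; field_simp; ring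
    _ ≤ |(z i : ℝ) - w i| * side N k := by gcongr
    _ = ‖(corner k z - corner k w : E N) i‖ := by
        rw [PiLp.sub_apply, Real.norm_eq_abs]
        simp only [corner]
        rw [← sub_mul, abs_mul, abs_of_pos hs]
    _ ≤ dist (corner (N := N) k z) (corner k w) := by
        rw [dist_eq_norm]; exact PiLp.norm_apply_le _ i

/-! ### Dyadic potentials and their energy -/

/-- The volume of a cube of generation `k`. -/
noncomputable def cubeVol (N k : ℕ) : ℝ≥0∞ := ENNReal.ofReal (side N k ^ N)

theorem cubeVol_ne_zero {N : ℕ} (hN : 1 ≤ N) (k : ℕ) : cubeVol N k ≠ 0 := by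
  have := side_pos hN k
  rw [cubeVol, Ne, ENNReal.ofReal_eq_zero, not_le]; positivity

theorem cubeVol_ne_top (N k : ℕ) : cubeVol N k ≠ ∞ := ENNReal.ofReal_ne_top

theorem cubeVol_succ {N : ℕ} (hN : 1 ≤ N) (k : ℕ) :
    (cubeVol N (k + 1))⁻¹ = 2 ^ N * (cubeVol N k)⁻¹ := by
  have hs := side_pos hN (k + 1)
  rw [cubeVol, cubeVol, side_succ N k, mul_pow, ENNReal.ofReal_mul (by positivity),
    ENNReal.mul_inv (by simp) (by simp), ENNReal.ofReal_pow two_pos.le, ENNReal.ofReal_ofNat,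
    mul_comm _ (2 ^ N)⁻¹, ← mul_assoc, ENNReal.mul_inv_cancel (by simp) (by simp), one_mul]

/-- The mass `∫_Q f` of the cube `Q` of generation `k` containing `x`. -/
noncomputable def cubeMass {N : ℕ} (f : E N → ℝ≥0∞) (k : ℕ) (x : E N) : ℝ≥0∞ :=
  ∫⁻ y in cube k (cubeIndex k x), f y

/-- The sum `∑_Q (∫_Q f)²`. -/
noncomputable def cubeEnergy {N : ℕ} (f : E N → ℝ≥0∞) (k : ℕ) : ℝ≥0∞ :=
  ∑' z : Fin N → ℤ, (∫⁻ y in cube k z, f y) ^ 2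

variable {N : ℕ}

theorem measurable_comp_cubeIndex {β : Type*} [MeasurableSpace β] (k : ℕ) (G : (Fin N → ℤ) → β) :
    Measurable fun x : E N => G (cubeIndex k x) :=
  (measurable_of_countable G).comp (measurable_cubeIndex k)

theorem measurable_cubeMass (f : E N → ℝ≥0∞) (k : ℕ) : Measurable (cubeMass f k) :=
  measurable_comp_cubeIndex k fun z => ∫⁻ y in cube k z, f y

theorem lintegral_eq_tsum_cube (f : E N → ℝ≥0∞) (k : ℕ) :
    ∫⁻ x, f x = ∑' z : Fin N → ℤ, ∫⁻ x in cube k z, f x := by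
  rw [← lintegral_iUnion (fun z => measurableSet_cube k z)]
  · have : (⋃ z : Fin N → ℤ, cube (N := N) k z) = univ :=
      eq_univ_of_forall fun x => mem_iUnion.2 ⟨cubeIndex k x, rfl⟩
    rw [this, setLIntegral_univ]
  · intro z w hzw
    exact disjoint_left.2 fun x hx hx' => hzw (hx.symm.trans hx')

/-- A function that depends on the cube only is integrated as a sum over the cubes. -/
theorem lintegral_mul_comp_cubeIndex {f : E N → ℝ≥0∞} (hf : Measurable f) (k : ℕ)
    (G : (Fin N → ℤ) → ℝ≥0∞) :
    ∫⁻ x, f x * G (cubeIndex k x) = ∑' z, (∫⁻ x in cube k z, f x) * G z := by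
  rw [lintegral_eq_tsum_cube _ k]
  refine tsum_congr fun z => ?_
  rw [← lintegral_mul_const _ hf]
  exact setLIntegral_congr_fun (measurableSet_cube k z) fun x hx => by
    simp only [mem_cube.1 hx]

theorem lintegral_mul_cubeMass {f g : E N → ℝ≥0∞} (hf : Measurable f) (k : ℕ) :
    ∫⁻ x, f x * cubeMass g k x =
      ∑' z, (∫⁻ x in cube k z, f x) * ∫⁻ x in cube k z, g x :=
  lintegral_mul_comp_cubeIndex hf k fun z => ∫⁻ x in cube k z, g x

theorem lintegral_mul_cubeMass_comm {f g : E N → ℝ≥0∞} (hf : Measurable f) (hg : Measurable g)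
    (k : ℕ) : ∫⁻ x, f x * cubeMass g k x = ∫⁻ x, g x * cubeMass f k x := by
  rw [lintegral_mul_cubeMass hf, lintegral_mul_cubeMass hg]
  simp_rw [mul_comm]

theorem lintegral_mul_cubeMass_self {f : E N → ℝ≥0∞} (hf : Measurable f) (k : ℕ) :
    ∫⁻ x, f x * cubeMass f k x = cubeEnergy f k := by
  rw [lintegral_mul_cubeMass hf, cubeEnergy]
  simp_rw [sq]

/-- `cubeMass f k` is constant on the cubes of the finer generation `l`. This is the orthogonality
that makes the generations add up in `ℓ²`. -/
theorem cubeMass_cubeMass (hN : 1 ≤ N) (f : E N → ℝ≥0∞) {k l : ℕ} (hkl : k ≤ l) (x : E N) :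
    cubeMass (cubeMass f k) l x = cubeMass f k x * cubeVol N l := by
  rw [cubeMass, setLIntegral_congr_fun (g := fun _ => cubeMass f k x) (measurableSet_cube l _),
    setLIntegral_const, volume_cube hN, cubeVol]
  intro y hy
  simp only [cubeMass, cubeIndex_eq_of_le hkl (mem_cube.1 hy)]

theorem lintegral_cubeMass_mul_cubeMass (hN : 1 ≤ N) {f : E N → ℝ≥0∞} (hf : Measurable f)
    {k l : ℕ} (hkl : k ≤ l) :
    ∫⁻ x, cubeMass f k x * cubeMass f l x = cubeEnergy f k * cubeVol N l := by
  rw [lintegral_mul_cubeMass_comm (measurable_cubeMass f k) hf]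
  simp_rw [cubeMass_cubeMass hN f hkl, ← mul_assoc]
  have hm := measurable_cubeMass f k
  rw [lintegral_mul_const _ (by fun_prop), lintegral_mul_cubeMass_self hf]

theorem ofReal_rad (k : ℕ) : ENNReal.ofReal (rad k) = 2⁻¹ ^ k := by
  rw [rad, ENNReal.ofReal_pow (by norm_num), ENNReal.ofReal_inv_of_pos two_pos,
    ENNReal.ofReal_ofNat]

theorem tsum_rad_add (k : ℕ) : ∑' j, ENNReal.ofReal (rad (k + j)) = 2 * ENNReal.ofReal (rad k) := by
  simp_rw [ofReal_rad, pow_add]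
  rw [ENNReal.tsum_mul_left, ENNReal.tsum_geometric, ENNReal.one_sub_inv_two, inv_inv, mul_comm]

/-- A dyadic substitute for the Riesz potential of order one: on the cube of generation `k` around
`x`, the kernel `|x - y|^{1-N}` is replaced by `2⁻ᵏ / |Q|`; only the generations from `k₀` on are
summed. -/
noncomputable def potential (f : E N → ℝ≥0∞) (k₀ : ℕ) (x : E N) : ℝ≥0∞ :=
  ∑' j, ENNReal.ofReal (rad (k₀ + j)) * (cubeVol N (k₀ + j))⁻¹ * cubeMass f (k₀ + j) x

theorem measurable_potential (f : E N → ℝ≥0∞) (k₀ : ℕ) : Measurable (potential f k₀) :=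
  Measurable.tsum fun j => (measurable_cubeMass f (k₀ + j)).const_mul _

/-- The dyadic potential is self-adjoint. -/
theorem lintegral_mul_potential_comm {f g : E N → ℝ≥0∞} (hf : Measurable f) (hg : Measurable g)
    (k₀ : ℕ) : ∫⁻ x, f x * potential g k₀ x = ∫⁻ x, g x * potential f k₀ x := by
  have key : ∀ {f g : E N → ℝ≥0∞} (_ : Measurable f), ∫⁻ x, f x * potential g k₀ x =
      ∑' j, ENNReal.ofReal (rad (k₀ + j)) * (cubeVol N (k₀ + j))⁻¹ *
        ∫⁻ x, f x * cubeMass g (k₀ + j) x := by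
    intro f g hf
    simp_rw [potential, ← ENNReal.tsum_mul_left]
    have hm : ∀ j, Measurable (cubeMass g (k₀ + j)) := fun j => measurable_cubeMass g _
    rw [lintegral_tsum fun j => by fun_prop]
    refine tsum_congr fun j => ?_
    rw [← lintegral_const_mul _ (by fun_prop)]
    exact lintegral_congr fun x => by ring
  rw [key hf, key hg]
  simp_rw [lintegral_mul_cubeMass_comm hf hg]

/-- A symmetric double sum is at most twice its part on and above the diagonal. -/
theorem tsum_tsum_le_of_symm {F T : ℕ → ℕ → ℝ≥0∞} (hsymm : ∀ i j, F i j = F j i)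
    (hle : ∀ i j, F i (i + j) ≤ T i j) : ∑' i, ∑' j, F i j ≤ 2 * ∑' i, ∑' j, T i j := by
  set G : ℕ → ℕ → ℝ≥0∞ := fun i j => if i ≤ j then F i j else 0
  have hG : ∀ i, ∑' j, G i j ≤ ∑' j, T i j := by
    intro i
    rw [← (ENNReal.summable.sum_add_tsum_nat_add' (k := i) (f := G i))]
    rw [Finset.sum_eq_zero fun j hj => if_neg (by simpa using hj), zero_add]
    refine ENNReal.tsum_le_tsum fun j => ?_
    simp only [G]
    rw [if_pos (by omega), add_comm]
    exact hle i j
  calc ∑' i, ∑' j, F i j ≤ ∑' i, ∑' j, (G i j + G j i) := by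
        refine ENNReal.tsum_le_tsum fun i => ENNReal.tsum_le_tsum fun j => ?_
        rcases le_total i j with h | h
        · simp [G, h]
        · simp [G, h, hsymm i j]
    _ = ∑' i, ∑' j, G i j + ∑' i, ∑' j, G i j := by
        simp_rw [ENNReal.tsum_add]
        congr 1
        exact ENNReal.tsum_comm
    _ ≤ 2 * ∑' i, ∑' j, T i j := by
        rw [← two_mul]
        gcongr 2 * ?_
        exact ENNReal.tsum_le_tsum hG

/-- The energy estimate: the `L²` norm of the potential is controlled by the square sums of the cube
masses, with no loss from the interaction of different generations. -/
theorem lintegral_potential_sq_le (hN : 1 ≤ N) {f : E N → ℝ≥0∞} (hf : Measurable f) (k₀ : ℕ) :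
    ∫⁻ x, potential f k₀ x ^ 2 ≤
      4 * ∑' j, ENNReal.ofReal (rad (k₀ + j)) ^ 2 * (cubeVol N (k₀ + j))⁻¹ *
        cubeEnergy f (k₀ + j) := by
  set w : ℕ → ℝ≥0∞ := fun j => ENNReal.ofReal (rad (k₀ + j)) * (cubeVol N (k₀ + j))⁻¹
  set m : ℕ → E N → ℝ≥0∞ := fun j => cubeMass f (k₀ + j)
  have hm : ∀ j, Measurable (m j) := fun j => measurable_cubeMass f _
  calc ∫⁻ x, potential f k₀ x ^ 2
      = ∫⁻ x, ∑' i, ∑' j, w i * w j * (m i x * m j x) := by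
        refine lintegral_congr fun x => ?_
        rw [sq]
        change (∑' i, w i * m i x) * (∑' j, w j * m j x) = _
        rw [← ENNReal.tsum_mul_right]
        refine tsum_congr fun i => ?_
        rw [← ENNReal.tsum_mul_left]
        exact tsum_congr fun j => by ring
    _ = ∑' i, ∑' j, w i * w j * ∫⁻ x, m i x * m j x := by
        rw [lintegral_tsum fun i =>
          (Measurable.tsum fun j => by fun_prop : Measurable _).aemeasurable]
        refine tsum_congr fun i => ?_
        rw [lintegral_tsum fun j => by fun_prop]
        exact tsum_congr fun j => lintegral_const_mul _ ((hm i).mul (hm j))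
    _ ≤ 2 * ∑' i, ∑' j, w i * cubeEnergy f (k₀ + i) * ENNReal.ofReal (rad (k₀ + i + j)) := by
        refine tsum_tsum_le_of_symm (fun i j => ?_) fun i j => le_of_eq ?_
        · simp_rw [mul_comm (m i _), mul_comm (w i)]
        · simp only [w, m]
          rw [lintegral_cubeMass_mul_cubeMass hN hf (by omega), ← add_assoc k₀ i j]
          calc _ = ENNReal.ofReal (rad (k₀ + i)) * (cubeVol N (k₀ + i))⁻¹ *
                cubeEnergy f (k₀ + i) * ENNReal.ofReal (rad (k₀ + i + j)) *
                ((cubeVol N (k₀ + i + j))⁻¹ * cubeVol N (k₀ + i + j)) := by ring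
            _ = _ := by
                rw [ENNReal.inv_mul_cancel (cubeVol_ne_zero hN _) (cubeVol_ne_top N _), mul_one]
    _ = _ := by
        simp_rw [ENNReal.tsum_mul_left, tsum_rad_add, ← ENNReal.tsum_mul_left]
        refine tsum_congr fun i => ?_
        simp only [w]
        ring

/-- The average of `φ` over the cube of generation `k` containing `x`. -/
noncomputable def cubeAvg (φ : E N → ℝ) (k : ℕ) (x : E N) : ℝ :=
  ⨍ y in cube k (cubeIndex k x), φ y

theorem enorm_cubeAvg_succ_sub_le (hN : 1 ≤ N) {φ : E N → ℝ} (hφ : ContDiff ℝ 1 φ)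
    (hφs : HasCompactSupport φ) (k : ℕ) (x : E N) :
    ‖cubeAvg φ (k + 1) x - cubeAvg φ k x‖ₑ ≤
      4 ^ N * (ENNReal.ofReal (rad k) * (cubeVol N k)⁻¹ *
        cubeMass (fun y => ‖fderiv ℝ φ y‖ₑ) k x) := by
  have h := enorm_average_sub_average_le (volume : Measure (E N))
    (P := cube (k + 1) (cubeIndex (k + 1) x)) (Q := cube k (cubeIndex k x))
    (measurableSet_cube k _) (fun y hy => cubeIndex_eq_of_le k.le_succ hy)
    (convex_cube hN k _) (by rw [volume_cube hN]; exact cubeVol_ne_zero hN _)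
    (by rw [volume_cube hN]; exact cubeVol_ne_top N _) (d := ENNReal.ofReal (rad k))
    (fun y hy z hz => by
      rw [← ofReal_norm]
      exact ENNReal.ofReal_le_ofReal (norm_sub_lt_of_mem_cube hN hy hz).le)
    ENNReal.ofReal_ne_top hφ hφs
  refine h.trans (le_of_eq ?_)
  rw [volume_cube hN, ← cubeVol, cubeVol_succ hN, finrank_euclideanSpace_fin, cubeMass,
    show (4 : ℝ≥0∞) = 2 * 2 by norm_num, mul_pow]
  ring

theorem tendsto_cubeAvg (hN : 1 ≤ N) {φ : E N → ℝ} (hφ : Continuous φ)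
    (hφs : HasCompactSupport φ) (x : E N) :
    Filter.Tendsto (fun k => cubeAvg φ k x) Filter.atTop (nhds (φ x)) := by
  rw [Metric.tendsto_atTop]
  intro ε hε
  obtain ⟨δ, hδ, h⟩ := Metric.continuous_iff.1 hφ x (ε / 2) (half_pos hε)
  obtain ⟨n, hn⟩ := exists_pow_lt_of_lt_one hδ (by norm_num : (2⁻¹ : ℝ) < 1)
  refine ⟨n, fun k hk => lt_of_le_of_lt ?_ (half_lt_self hε)⟩
  have hrad : rad k < δ := lt_of_le_of_lt
    (pow_le_pow_of_le_one (by norm_num) (by norm_num) hk) hn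
  refine Convex.set_average_mem (s := Metric.closedBall (φ x) (ε / 2)) (convex_closedBall _ _)
    Metric.isClosed_closedBall (by rw [volume_cube hN]; exact cubeVol_ne_zero hN k)
    (by rw [volume_cube hN]; exact cubeVol_ne_top N k) ?_
    (hφ.integrable_of_hasCompactSupport hφs).integrableOn
  refine ae_restrict_of_forall_mem (measurableSet_cube k _) fun y hy => (h y ?_).le
  rw [dist_eq_norm]
  exact (norm_sub_lt_of_mem_cube hN hy rfl).trans hrad

/-- Telescoping the cube averages of `φ` bounds the deviation by the potential of `|∇φ|`. -/
theorem enorm_sub_cubeAvg_le (hN : 1 ≤ N) {φ : E N → ℝ} (hφ : ContDiff ℝ 1 φ)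
    (hφs : HasCompactSupport φ) (k₀ : ℕ) (x : E N) :
    ‖φ x - cubeAvg φ k₀ x‖ₑ ≤ 4 ^ N * potential (fun y => ‖fderiv ℝ φ y‖ₑ) k₀ x := by
  have h := edist_le_tsum_of_edist_le_of_tendsto₀ (f := fun j => cubeAvg φ (k₀ + j) x)
    (fun j => 4 ^ N * (ENNReal.ofReal (rad (k₀ + j)) * (cubeVol N (k₀ + j))⁻¹ *
        cubeMass (fun y => ‖fderiv ℝ φ y‖ₑ) (k₀ + j) x))
    (fun j => by
      rw [edist_comm, edist_eq_enorm_sub]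
      exact enorm_cubeAvg_succ_sub_le hN hφ hφs (k₀ + j) x)
    (a := φ x) (by
      have := (tendsto_cubeAvg hN hφ.continuous hφs x).comp
        (Filter.tendsto_add_atTop_nat k₀)
      simpa [Function.comp_def, add_comm] using this)
  rw [edist_comm, edist_eq_enorm_sub, ENNReal.tsum_mul_left] at h
  simpa [potential] using h

/-- The pairing of `f` with the deviation of `φ` from its cube averages is bounded by the energy of
`f` at the scales below `2^{-k₀}`: move the potential from `|∇φ|` to `f`, then
apply Cauchy–Schwarz. -/
theorem lintegral_mul_sub_cubeAvg_le (hN : 1 ≤ N) {f : E N → ℝ≥0∞} (hf : Measurable f)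
    {φ : E N → ℝ} (hφ : ContDiff ℝ 1 φ) (hφs : HasCompactSupport φ) (k₀ : ℕ) :
    ∫⁻ x, f x * ‖φ x - cubeAvg φ k₀ x‖ₑ ≤
      4 ^ N * ((∫⁻ x, ‖fderiv ℝ φ x‖ₑ ^ 2) ^ (1 / 2 : ℝ) *
        (4 * ∑' j, ENNReal.ofReal (rad (k₀ + j)) ^ 2 * (cubeVol N (k₀ + j))⁻¹ *
          cubeEnergy f (k₀ + j)) ^ (1 / 2 : ℝ)) := by
  have hg : Measurable fun y => ‖fderiv ℝ φ y‖ₑ :=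
    (hφ.continuous_fderiv (by simp)).enorm.measurable
  calc ∫⁻ x, f x * ‖φ x - cubeAvg φ k₀ x‖ₑ
      ≤ ∫⁻ x, 4 ^ N * (f x * potential (fun y => ‖fderiv ℝ φ y‖ₑ) k₀ x) := by
        refine lintegral_mono fun x => ?_
        rw [mul_left_comm]
        gcongr
        exact enorm_sub_cubeAvg_le hN hφ hφs k₀ x
    _ = 4 ^ N * ∫⁻ x, ‖fderiv ℝ φ x‖ₑ * potential f k₀ x := by
        rw [lintegral_const_mul' _ _ (by simp), lintegral_mul_potential_comm hf hg]
    _ ≤ 4 ^ N * ((∫⁻ x, ‖fderiv ℝ φ x‖ₑ ^ (2 : ℝ)) ^ (1 / 2 : ℝ) *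
          (∫⁻ x, potential f k₀ x ^ (2 : ℝ)) ^ (1 / 2 : ℝ)) := by
        gcongr
        exact ENNReal.lintegral_mul_le_Lp_mul_Lq volume Real.HolderConjugate.two_two
          hg.aemeasurable (measurable_potential f k₀).aemeasurable
    _ ≤ _ := by
        simp_rw [ENNReal.rpow_two]
        gcongr
        exact lintegral_potential_sq_le hN hf k₀

/-! ### Ball packings and the decay of the energy -/

/-- The weight `R^{N/p} |log R|^α` of a ball of radius `R = 2⁻ᵏ`. It is meaningful only for `k ≠ 0`,
as `log 1 = 0`. -/
noncomputable def ballWeight (N : ℕ) (p α : ℝ) (k : ℕ) : ℝ :=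
  rad k ^ ((N : ℝ) / p) * |Real.log (rad k)| ^ α

theorem log_rad (k : ℕ) : Real.log (rad k) = -(k * Real.log 2) := by
  rw [rad, Real.log_pow, Real.log_inv]; ring

theorem abs_log_rad (k : ℕ) : |Real.log (rad k)| = k * Real.log 2 := by
  rw [log_rad, abs_neg, abs_of_nonneg (mul_nonneg k.cast_nonneg (Real.log_pos one_lt_two).le)]

theorem ballWeight_pos (N : ℕ) (p α : ℝ) {k : ℕ} (hk : k ≠ 0) : 0 < ballWeight N p α k := by
  have hk' : (0 : ℝ) < k := by exact_mod_cast hk.bot_lt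
  have h2 := Real.log_pos one_lt_two
  rw [ballWeight, abs_log_rad]
  exact mul_pos (Real.rpow_pos_of_pos (rad_pos k) _) (Real.rpow_pos_of_pos (mul_pos hk' h2) _)

theorem tsum_sq_le_of_vNorm_le {p α R₀ : ℝ} {Ω : Set (E N)} {f : E N → ℝ} {C : ℝ≥0∞}
    (hC : vNorm p 2 α R₀ Ω f ≤ C) {𝓑 : Set (E N × ℝ)} (h𝓑 : IsBallPacking Ω R₀ 𝓑) :
    ∑' b : 𝓑, (ENNReal.ofReal (b.1.2 ^ ((N : ℝ) / p) * |Real.log b.1.2| ^ α) *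
      ⨍⁻ x in Metric.ball b.1.1 b.1.2, ‖f x‖ₑ ∂volume) ^ 2 ≤ C ^ 2 := by
  have h := (le_iSup₂ (f := fun (𝓑 : Set (E N × ℝ)) (_ : IsBallPacking Ω R₀ 𝓑) =>
    (∑' b : 𝓑, (ENNReal.ofReal (b.1.2 ^ ((N : ℝ) / p) * |Real.log b.1.2| ^ α) *
      ⨍⁻ x in Metric.ball b.1.1 b.1.2, ‖f x‖ₑ ∂volume) ^ (2 : ℝ)) ^ (1 / 2 : ℝ)) 𝓑 h𝓑).trans hC
  rw [one_div, ENNReal.rpow_inv_le_iff two_pos] at h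
  simpa only [ENNReal.rpow_two] using h

/-- The contribution of one residue class of cubes modulo `4N` is bounded by the norm. Only the
cubes that meet the support are kept, so that their balls lie in `Ω`. -/
theorem tsum_cube_class_le (hN : 1 ≤ N) {p α R₀ : ℝ} {Ω : Set (E N)} {f : E N → ℝ}
    {C : ℝ≥0∞} (hC : vNorm p 2 α R₀ Ω f ≤ C) {K : Set (E N)} {k : ℕ}
    (hk : rad k ≤ R₀) (hkΩ : ∀ x ∈ K, Metric.ball x (2 * rad k) ⊆ Ω)
    (c : Fin N → ZMod (4 * N)) :
    ∑' z : {z : Fin N → ℤ | (∀ i, (z i : ZMod (4 * N)) = c i) ∧ (cube k z ∩ K).Nonempty},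
      (ENNReal.ofReal (ballWeight N p α k) * ((volume (Metric.ball (0 : E N) (rad k)))⁻¹ *
        ∫⁻ x in cube k z.1, ‖f x‖ₑ)) ^ 2 ≤ C ^ 2 := by
  set S := {z : Fin N → ℤ | (∀ i, (z i : ZMod (4 * N)) = c i) ∧ (cube k z ∩ K).Nonempty}
  set B : (Fin N → ℤ) → E N × ℝ := fun z => (corner k z, rad k)
  have hdisj : S.Pairwise fun z w => Disjoint (Metric.ball (B z).1 (B z).2)
      (Metric.ball (B w).1 (B w).2) := fun z hz w hw hzw =>
    disjoint_ball_corner hzw fun i => (hz.1 i).trans (hw.1 i).symm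
  have hinj : InjOn B S := by
    intro z hz w hw hzw
    by_contra hne
    have := hdisj hz hw hne
    simp only [hzw, disjoint_self] at this
    exact (Metric.nonempty_ball.2 (rad_pos k)).ne_empty this
  have hpack : IsBallPacking Ω R₀ (B '' S) := by
    refine ⟨?_, ?_⟩
    · rintro _ ⟨z, ⟨-, x, hx, hxK⟩, rfl⟩
      refine ⟨rad_pos k, hk, Subset.trans (Metric.ball_subset_ball' ?_) (hkΩ x hxK)⟩
      have := cube_subset_ball hN k z hx
      rw [Metric.mem_ball, dist_comm] at this
      simp only [B]
      linarith
    · rintro _ ⟨z, hz, rfl⟩ _ ⟨w, hw, rfl⟩ hne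
      exact hdisj hz hw fun h => hne (by rw [h])
  refine le_trans ?_ (tsum_sq_le_of_vNorm_le hC hpack)
  rw [tsum_image (fun b : E N × ℝ => (ENNReal.ofReal (b.2 ^ ((N : ℝ) / p) *
    |Real.log b.2| ^ α) * ⨍⁻ x in Metric.ball b.1 b.2, ‖f x‖ₑ ∂volume) ^ 2) hinj]
  refine ENNReal.tsum_le_tsum fun z => ?_
  rw [setLAverage_eq, ENNReal.div_eq_inv_mul,
    ← Measure.addHaar_ball_center volume (corner k z.1) (rad k)]
  gcongr ?_ ^ 2
  refine mul_le_mul' le_rfl (mul_le_mul' le_rfl ?_)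
  exact lintegral_mono_set (cube_subset_ball hN k z.1)

/-- The square sum of the cube masses is controlled by the norm, at all small scales. -/
theorem cubeEnergy_le (hN : 1 ≤ N) {p α R₀ : ℝ} {Ω : Set (E N)} {f : E N → ℝ}
    {C : ℝ≥0∞} (hC : vNorm p 2 α R₀ Ω f ≤ C) {K : Set (E N)} (hfK : tsupport f ⊆ K) {k : ℕ}
    (hk0 : k ≠ 0) (hk : rad k ≤ R₀) (hkΩ : ∀ x ∈ K, Metric.ball x (2 * rad k) ⊆ Ω) :
    cubeEnergy (fun x => ‖f x‖ₑ) k ≤ (4 * N) ^ N * C ^ 2 *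
      (volume (Metric.ball (0 : E N) (rad k)) / ENNReal.ofReal (ballWeight N p α k)) ^ 2 := by
  have : NeZero (4 * N) := ⟨by omega⟩
  set S : (Fin N → ZMod (4 * N)) → Set (Fin N → ℤ) := fun c =>
    {z : Fin N → ℤ | (∀ i, (z i : ZMod (4 * N)) = c i) ∧ (cube k z ∩ K).Nonempty}
  set W := ENNReal.ofReal (ballWeight N p α k)
  set β := volume (Metric.ball (0 : E N) (rad k))
  set m : (Fin N → ℤ) → ℝ≥0∞ := fun z => ∫⁻ x in cube k z, ‖f x‖ₑ
  have hW0 : W ≠ 0 := by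
    simpa [W, ENNReal.ofReal_eq_zero, not_le] using ballWeight_pos N p α hk0
  have hWt : W ≠ ∞ := ENNReal.ofReal_ne_top
  have hβ0 : β ≠ 0 := (Metric.measure_ball_pos _ _ (rad_pos k)).ne'
  have hβt : β ≠ ∞ := measure_ball_lt_top.ne
  have hm0 : ∀ z, ¬ (cube k z ∩ K).Nonempty → m z = 0 := by
    intro z hz
    have : ∀ x ∈ cube k z, ‖f x‖ₑ = 0 := fun x hx => by
      rw [enorm_eq_zero]
      by_contra h
      exact hz ⟨x, hx, hfK (subset_tsupport f h)⟩
    simp only [m]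
    rw [setLIntegral_congr_fun (g := fun _ => 0) (measurableSet_cube k z) this, lintegral_zero]
  have hclass : ∀ c, ∑' z : S c, m z ^ 2 ≤ (β / W) ^ 2 * C ^ 2 := by
    intro c
    calc ∑' z : S c, m z ^ 2 = ∑' z : S c, (β / W) ^ 2 * (W * (β⁻¹ * m z)) ^ 2 := by
          refine tsum_congr fun z => ?_
          rw [← mul_pow]
          congr 1
          calc m z = (W * W⁻¹) * (β * β⁻¹) * m z := by
                rw [ENNReal.mul_inv_cancel hW0 hWt, ENNReal.mul_inv_cancel hβ0 hβt]; simp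
            _ = _ := by rw [div_eq_mul_inv]; ring
      _ = (β / W) ^ 2 * ∑' z : S c, (W * (β⁻¹ * m z)) ^ 2 := ENNReal.tsum_mul_left
      _ ≤ (β / W) ^ 2 * C ^ 2 := by
          gcongr 1
          exact tsum_cube_class_le hN hC hk hkΩ c
  calc cubeEnergy (fun x => ‖f x‖ₑ) k = ∑' z, m z ^ 2 := rfl
    _ ≤ ∑' z, ∑ c, (S c).indicator (fun z => m z ^ 2) z := by
        refine ENNReal.tsum_le_tsum fun z => ?_
        by_cases hz : (cube k z ∩ K).Nonempty
        · have hmem : z ∈ S fun i => (z i : ZMod (4 * N)) := ⟨fun _ => rfl, hz⟩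
          refine le_trans (le_of_eq ?_) (Finset.single_le_sum (fun _ _ => zero_le)
            (Finset.mem_univ fun i => (z i : ZMod (4 * N))))
          rw [indicator_of_mem hmem]
        · rw [hm0 z hz]; simp
    _ = ∑ c, ∑' z : S c, m z ^ 2 := by
        rw [Summable.tsum_finsetSum fun _ _ => ENNReal.summable]
        exact Finset.sum_congr rfl fun c _ => (tsum_subtype (S c) fun z => m z ^ 2).symm
    _ ≤ ∑ _c : Fin N → ZMod (4 * N), (β / W) ^ 2 * C ^ 2 := Finset.sum_le_sum fun c _ => hclass c
    _ = _ := by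
        rw [Finset.sum_const, Finset.card_univ, Fintype.card_fun, ZMod.card, Fintype.card_fin,
          nsmul_eq_mul]
        push_cast
        ring

/-- The bound for the contribution `2^{-2k} |Q|⁻¹ ∑_Q (∫_Q |f|)²` of generation `k` to the energy,
up to a constant that does not depend on `k`. -/
noncomputable def decay (N : ℕ) (p α : ℝ) (k : ℕ) : ℝ :=
  rad k ^ 2 * (side N k ^ N)⁻¹ * (rad k ^ N / ballWeight N p α k) ^ 2

theorem rad_sq_mul_cubeEnergy_le (hN : 1 ≤ N) {p α R₀ : ℝ} {Ω : Set (E N)} {f : E N → ℝ}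
    {C : ℝ≥0∞} (hC : vNorm p 2 α R₀ Ω f ≤ C) {K : Set (E N)} (hfK : tsupport f ⊆ K) {k : ℕ}
    (hk0 : k ≠ 0) (hk : rad k ≤ R₀) (hkΩ : ∀ x ∈ K, Metric.ball x (2 * rad k) ⊆ Ω) :
    ENNReal.ofReal (rad k) ^ 2 * (cubeVol N k)⁻¹ * cubeEnergy (fun x => ‖f x‖ₑ) k ≤
      (4 * N) ^ N * C ^ 2 * volume (Metric.ball (0 : E N) 1) ^ 2 *
        ENNReal.ofReal (decay N p α k) := by
  have hr := rad_pos k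
  have hs := side_pos hN k
  have hw := ballWeight_pos N p α hk0
  refine (mul_le_mul' le_rfl (cubeEnergy_le hN hC hfK hk0 hk hkΩ)).trans (le_of_eq ?_)
  rw [Measure.addHaar_ball_of_pos _ _ hr, finrank_euclideanSpace_fin, decay, cubeVol,
    ENNReal.ofReal_mul (by positivity), ENNReal.ofReal_mul (by positivity),
    ENNReal.ofReal_pow (by positivity) 2, ENNReal.ofReal_pow (by positivity) 2,
    ENNReal.ofReal_inv_of_pos (by positivity), ENNReal.ofReal_div_of_pos hw, div_eq_mul_inv,
    div_eq_mul_inv]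
  ring

/-- The contribution of generation `k` is `2^{-kγ} k^{-2α}` up to a constant, with
`γ = N + 2 - 2N/p`. The exponent `γ` vanishes exactly for the critical `p = 2N/(N+2)`. -/
theorem decay_eq (hN : 1 ≤ N) {p α : ℝ} {k : ℕ} (hk : k ≠ 0) :
    decay N p α k = ((2 * N) ^ N * Real.log 2 ^ (-(2 * α))) *
      ((2⁻¹ ^ (N + 2 - 2 * N / p) : ℝ) ^ k * (k : ℝ) ^ (-(2 * α))) := by
  have hr := rad_pos k
  have hk' : (0 : ℝ) < k := by exact_mod_cast hk.bot_lt
  have h2 := Real.log_pos one_lt_two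
  have hN' : (0 : ℝ) < N := by exact_mod_cast hN
  have e1 : (2⁻¹ ^ (N + 2 - 2 * N / p) : ℝ) ^ k =
      rad k ^ N * rad k ^ 2 * ((rad k ^ ((N : ℝ) / p)) ^ 2)⁻¹ := by
    rw [← Real.rpow_natCast, ← Real.rpow_mul (by norm_num), mul_comm _ (k : ℝ),
      Real.rpow_mul (by norm_num), Real.rpow_natCast, ← rad, Real.rpow_sub hr, Real.rpow_add hr,
      Real.rpow_natCast, Real.rpow_ofNat, div_eq_mul_inv, ← Real.rpow_natCast (rad k ^ _) 2,
      ← Real.rpow_mul hr.le]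
    congr 3
    push_cast; ring
  have e2 : (|Real.log (rad k)| ^ α) ^ 2 = ((k : ℝ) ^ (-(2 * α)) * Real.log 2 ^ (-(2 * α)))⁻¹ := by
    rw [abs_log_rad, ← Real.mul_rpow hk'.le h2.le, Real.rpow_neg (mul_pos hk' h2).le, inv_inv,
      ← Real.rpow_natCast, ← Real.rpow_mul (mul_pos hk' h2).le, mul_comm α]
    norm_num
  rw [e1, decay, ballWeight, div_pow, mul_pow (rad k ^ ((N : ℝ) / p)), e2, side, div_pow]
  have h3 : rad k ^ ((N : ℝ) / p) ≠ 0 := (Real.rpow_pos_of_pos hr _).ne'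
  have h4 : (k : ℝ) ^ (-(2 * α)) ≠ 0 := (Real.rpow_pos_of_pos hk' _).ne'
  have h5 : Real.log 2 ^ (-(2 * α)) ≠ 0 := (Real.rpow_pos_of_pos h2 _).ne'
  field_simp

theorem summable_decay (hN : 1 ≤ N) {p α : ℝ} (hp : 1 ≤ p)
    (h : 2 * (N : ℝ) / (N + 2) < p ∨ (p = 2 * (N : ℝ) / (N + 2) ∧ 1 / 2 < α)) :
    Summable (decay N p α) := by
  have hN' : (0 : ℝ) < N := by exact_mod_cast hN
  have hp0 : 0 < p := by linarith
  suffices hs : Summable fun k : ℕ =>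
      (2⁻¹ ^ (N + 2 - 2 * N / p) : ℝ) ^ k * (k : ℝ) ^ (-(2 * α)) by
    refine (hs.mul_left ((2 * N) ^ N * Real.log 2 ^ (-(2 * α)))).congr_atTop ?_
    filter_upwards [Filter.eventually_ne_atTop 0] with k hk
    exact (decay_eq hN hk).symm
  rcases h with h | ⟨h, hα⟩
  · have hγ : 0 < (N : ℝ) + 2 - 2 * N / p := by
      rw [div_lt_iff₀ (by positivity)] at h
      rw [sub_pos, div_lt_iff₀ hp0]; linarith
    set q : ℝ := 2⁻¹ ^ (N + 2 - 2 * N / p)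
    have hq0 : 0 < q := Real.rpow_pos_of_pos (by norm_num) _
    have hq1 : q < 1 := Real.rpow_lt_one (by norm_num) (by norm_num) hγ
    obtain ⟨n, hn⟩ := exists_nat_ge (-(2 * α))
    have hsum := summable_pow_mul_geometric_of_norm_lt_one n (r := q)
      (by rwa [Real.norm_eq_abs, abs_of_pos hq0])
    refine Summable.of_norm_bounded_eventually_nat hsum ?_
    filter_upwards [Filter.eventually_ge_atTop 1] with k hk
    have hk' : (1 : ℝ) ≤ k := by exact_mod_cast hk
    rw [Real.norm_of_nonneg (by positivity), mul_comm]
    gcongr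
    rw [← Real.rpow_natCast]
    exact Real.rpow_le_rpow_of_exponent_le hk' hn
  · have hγ : (N : ℝ) + 2 - 2 * N / p = 0 := by
      rw [h]; field_simp; ring
    simp only [hγ, Real.rpow_zero, one_pow, one_mul]
    exact Real.summable_nat_rpow.2 (by linarith)

/-! ### The dual of `H¹` inside `H⁻¹_loc` -/

/-- The test functions, equipped with the `H¹` norm. Its dual is `H⁻¹(ℝ^N)`, test functions being
dense in `H¹(ℝ^N)`. -/
def H1Test (N : ℕ) : Type := Test N

theorem Test.contDiff_one (φ : Test N) : ContDiff ℝ 1 φ :=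
  φ.contDiff.of_le (by exact_mod_cast le_top)

theorem Test.differentiableAt (φ : Test N) (x : E N) : DifferentiableAt ℝ φ x :=
  φ.contDiff_one.differentiable (by simp) x

theorem Test.continuous_gradient (φ : Test N) : Continuous (gradient φ) :=
  (InnerProductSpace.toDual ℝ (E N)).symm.continuous.comp
    (φ.contDiff_one.continuous_fderiv (by simp))

theorem Test.gradient_add (φ ψ : Test N) (x : E N) :
    gradient (φ + ψ : Test N) x = gradient φ x + gradient ψ x := by
  have h : fderiv ℝ (φ + ψ : Test N) x = fderiv ℝ φ x + fderiv ℝ ψ x :=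
    fderiv_add (φ.differentiableAt x) (ψ.differentiableAt x)
  simp only [gradient, h, map_add]

theorem Test.gradient_smul (c : ℝ) (φ : Test N) (x : E N) :
    gradient (c • φ : Test N) x = c • gradient φ x := by
  have h : fderiv ℝ (c • φ : Test N) x = c • fderiv ℝ φ x :=
    fderiv_const_smul (φ.differentiableAt x) c
  simp only [gradient, h, map_smul]

theorem Test.norm_gradient (φ : Test N) (x : E N) : ‖gradient φ x‖ = ‖fderiv ℝ φ x‖ :=
  LinearIsometryEquiv.norm_map _ _

theorem integrable_h1Inner (φ ψ : Test N) :
    Integrable fun x => φ x * ψ x + inner ℝ (gradient φ x) (gradient ψ x) := by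
  refine Integrable.add ?_ ?_
  · exact (φ.continuous.mul ψ.continuous).integrable_of_hasCompactSupport
      φ.hasCompactSupport.mul_right
  · refine (φ.continuous_gradient.inner ψ.continuous_gradient).integrable_of_hasCompactSupport ?_
    refine (φ.hasCompactSupport.fderiv (𝕜 := ℝ)).mono fun x hx => ?_
    rw [Function.mem_support] at hx ⊢
    contrapose! hx
    simp [gradient, hx]

/-- The `H¹` inner product of test functions. -/
@[reducible]
noncomputable def h1Core (N : ℕ) : PreInnerProductSpace.Core ℝ (Test N) where
  inner φ ψ := ∫ x, (φ x * ψ x + inner ℝ (gradient φ x) (gradient ψ x))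
  conj_inner_symm φ ψ := by
    rw [conj_trivial]
    refine integral_congr_ae (.of_forall fun x => ?_)
    simp only
    rw [mul_comm, real_inner_comm]
  re_inner_nonneg φ := integral_nonneg fun x =>
    add_nonneg (mul_self_nonneg _) real_inner_self_nonneg
  add_left φ ψ χ := by
    rw [← integral_add (integrable_h1Inner φ χ) (integrable_h1Inner ψ χ)]
    refine integral_congr_ae (.of_forall fun x => ?_)
    simp only
    rw [Test.gradient_add, inner_add_left, add_apply]
    ring
  smul_left φ ψ c := by
    rw [conj_trivial, ← integral_const_mul]
    refine integral_congr_ae (.of_forall fun x => ?_)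
    simp only
    rw [Test.gradient_smul, real_inner_smul_left, smul_apply, smul_eq_mul]
    ring

noncomputable instance : SeminormedAddCommGroup (H1Test N) :=
  @InnerProductSpace.Core.toSeminormedAddCommGroup ℝ (Test N) _ _ _ (h1Core N)

noncomputable instance : NormedSpace ℝ (H1Test N) :=
  @InnerProductSpace.Core.toNormedSpace ℝ (Test N) _ _ _ (h1Core N)

/-- The identity map from test functions to test functions with the `H¹` norm. -/
noncomputable def toH1 : Test N ≃ₗ[ℝ] H1Test N := LinearEquiv.refl ℝ (Test N)

theorem norm_toH1 (φ : Test N) : ‖toH1 φ‖ = h1Norm φ := by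
  change √(∫ x, (φ x * φ x + inner ℝ (gradient φ x) (gradient φ x))) = _
  rw [h1Norm]
  congr 1
  refine integral_congr_ae (.of_forall fun x => ?_)
  simp only
  rw [real_inner_self_eq_norm_sq, Test.norm_gradient, sq (φ x)]

theorem h1Norm_nonneg (φ : Test N) : 0 ≤ h1Norm φ := Real.sqrt_nonneg _

theorem integrable_h1Norm (φ : Test N) : Integrable fun x => φ x ^ 2 + ‖fderiv ℝ φ x‖ ^ 2 := by
  refine (integrable_h1Inner φ φ).congr (.of_forall fun x => ?_)
  simp only
  rw [real_inner_self_eq_norm_sq, Test.norm_gradient, sq (φ x)]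

/-- Multiplication by a test function is bounded for the `H¹` norm. -/
theorem exists_h1Norm_mulTest_le (χ : Test N) :
    ∃ C : ℝ≥0, ∀ φ : Test N, h1Norm (mulTest χ φ) ≤ C * h1Norm φ := by
  obtain ⟨A, hA⟩ := χ.continuous.bounded_above_of_compact_support χ.hasCompactSupport
  obtain ⟨B, hB⟩ := (χ.contDiff_one.continuous_fderiv (by simp)).bounded_above_of_compact_support
    (χ.hasCompactSupport.fderiv (𝕜 := ℝ))
  have hA0 : 0 ≤ A := (norm_nonneg _).trans (hA 0)
  have hB0 : 0 ≤ B := (norm_nonneg _).trans (hB 0)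
  refine ⟨Real.toNNReal (2 * (A + B)), fun φ => ?_⟩
  rw [Real.coe_toNNReal _ (by positivity)]
  have hint := integrable_h1Norm φ
  rw [h1Norm, Real.sqrt_le_left (mul_nonneg (by positivity) (h1Norm_nonneg φ)), mul_pow, h1Norm,
    Real.sq_sqrt (integral_nonneg fun x => by positivity), ← integral_const_mul]
  refine integral_mono (integrable_h1Norm _) (hint.const_mul _) fun x => ?_
  have hd : fderiv ℝ (mulTest χ φ) x = χ x • fderiv ℝ φ x + φ x • fderiv ℝ χ x :=
    fderiv_mul (χ.differentiableAt x) (φ.differentiableAt x)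
  have h1 : ‖fderiv ℝ (mulTest χ φ) x‖ ≤ A * ‖fderiv ℝ φ x‖ + B * |φ x| := by
    rw [hd]
    refine (norm_add_le _ _).trans ?_
    rw [norm_smul, norm_smul, mul_comm ‖φ x‖]
    gcongr
    · exact hA x
    · exact hB x
    · exact le_rfl
  have h2 : |χ x * φ x| ≤ A * |φ x| := by
    rw [abs_mul]
    gcongr
    exact hA x
  have h3 : (mulTest χ φ) x ^ 2 ≤ (A * |φ x|) ^ 2 := by
    rw [← sq_abs]
    exact pow_le_pow_left₀ (abs_nonneg _) h2 2
  have h4 := pow_le_pow_left₀ (norm_nonneg _) h1 2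
  simp only
  rw [← sq_abs (φ x)]
  refine (add_le_add h3 h4).trans ?_
  have hAB := mul_nonneg hA0 hB0
  generalize |φ x| = a
  generalize ‖fderiv ℝ φ x‖ = b
  nlinarith [sq_nonneg (A * b - B * a), mul_nonneg hAB (sq_nonneg a),
    mul_nonneg hAB (sq_nonneg b), sq_nonneg (A * a), sq_nonneg (B * b), sq_nonneg (A * b),
    sq_nonneg (B * a)]

/-- On functions supported in a fixed compact set, the `H¹` norm is dominated by the `C¹` norm; this
makes functionals on `H¹` continuous on the space of test functions. -/
theorem h1Norm_le_of_bound {K : Set (E N)} (hK : IsCompact K) {φ : Test N} (hφ : tsupport φ ⊆ K)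
    {P : ℝ} (hP : 0 ≤ P) (h0 : ∀ x, ‖φ x‖ ≤ P) (h1 : ∀ x, ‖fderiv ℝ φ x‖ ≤ P) :
    h1Norm φ ≤ √(2 * volume.real K) * P := by
  rw [h1Norm]
  conv_rhs => rw [← Real.sqrt_sq hP, ← Real.sqrt_mul (by positivity)]
  refine Real.sqrt_le_sqrt ?_
  rw [← setIntegral_eq_integral_of_forall_compl_eq_zero (s := K)]
  · refine (setIntegral_mono (g := fun _ => 2 * P ^ 2) (integrable_h1Norm φ).integrableOn
      (integrableOn_const hK.measure_lt_top.ne) fun x => ?_).trans (le_of_eq ?_)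
    · have h0' := h0 x
      rw [Real.norm_eq_abs] at h0'
      have h2 := pow_le_pow_left₀ (abs_nonneg _) h0' 2
      have h3 := pow_le_pow_left₀ (norm_nonneg _) (h1 x) 2
      rw [sq_abs] at h2
      simp only
      linarith
    · rw [setIntegral_const, smul_eq_mul]; ring
  · intro x hx
    have hx' : x ∉ tsupport φ := fun h => hx (hφ h)
    rw [image_eq_zero_of_notMem_tsupport hx',
      fderiv_of_notMem_tsupport (𝕜 := ℝ) hx']
    simp

/-- A linear functional that is bounded for the `H¹` norm is a distribution. -/
noncomputable def dualToDistribution (ℓ : StrongDual ℝ (H1Test N)) :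
    𝓓'((⊤ : Opens (E N)), ℝ) :=
  TestFunction.mkCLM ℝ (fun φ : Test N => ℓ (toH1 φ)) (fun φ ψ => by simp)
    (fun c φ => by simp) fun K hK => by
      refine (ContDiffMapSupportedIn.mkCLMtoNormedSpace (𝕜 := ℝ)
        (fun φ : 𝓓_{K}(E N, ℝ) => ℓ (toH1 (TestFunction.ofSupportedIn hK φ)))
        (fun φ ψ => ?_) (fun c φ => ?_) ?_).continuous
      · rw [← map_add, ← map_add]; rfl
      · rw [← map_smul, ← map_smul]; rfl
      refine ⟨{0, 1}, ‖ℓ‖ * √(2 * volume.real (K : Set (E N))), by positivity, fun φ => ?_⟩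
      set P := (({0, 1} : Finset ℕ).sup fun i => ContDiffMapSupportedIn.seminorm ℝ (E N) ℝ ⊤ K i) φ
      have hP0 : 0 ≤ P := apply_nonneg _ _
      refine (ℓ.le_opNorm _).trans ?_
      rw [mul_assoc]
      gcongr
      rw [norm_toH1]
      refine h1Norm_le_of_bound K.isCompact φ.tsupport_subset hP0 (fun x => ?_) fun x => ?_
      · refine (ContDiffMapSupportedIn.norm_apply_le_seminorm ℝ).trans ?_
        exact Seminorm.le_def.1 (Finset.le_sup (f := fun i =>
          ContDiffMapSupportedIn.seminorm ℝ (E N) ℝ ⊤ K i) (by simp : 0 ∈ ({0, 1} : Finset ℕ))) φ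
      · have h1 := ContDiffMapSupportedIn.norm_iteratedFDeriv_apply_le_seminorm_top ℝ
          (f := φ) (i := 1) (x := x)
        rw [norm_iteratedFDeriv_one] at h1
        refine h1.trans ?_
        exact Seminorm.le_def.1 (Finset.le_sup (f := fun i =>
          ContDiffMapSupportedIn.seminorm ℝ (E N) ℝ ⊤ K i) (by simp : 1 ∈ ({0, 1} : Finset ℕ))) φ

theorem dualToDistribution_apply (ℓ : StrongDual ℝ (H1Test N)) (φ : Test N) :
    dualToDistribution ℓ φ = ℓ (toH1 φ) := rfl

theorem abs_dual_mulTest_le {χ : Test N} {C : ℝ≥0}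
    (hC : ∀ φ : Test N, h1Norm (mulTest χ φ) ≤ C * h1Norm φ) (ℓ : StrongDual ℝ (H1Test N))
    (φ : Test N) : |dualToDistribution ℓ (mulTest χ φ)| ≤ C * ‖ℓ‖ * h1Norm φ := by
  rw [dualToDistribution_apply]
  refine (ℓ.le_opNorm _).trans ?_
  rw [norm_toH1, mul_comm (C : ℝ), mul_assoc]
  exact mul_le_mul_of_nonneg_left (hC φ) (norm_nonneg ℓ)

/-- The inclusion of the dual of `H¹` in `H⁻¹_loc`. -/
noncomputable def dualToHNegOneLoc : StrongDual ℝ (H1Test N) →ₗ[ℝ] HNegOneLoc N where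
  toFun ℓ := ⟨dualToDistribution ℓ, fun χ => by
    obtain ⟨C, hC⟩ := exists_h1Norm_mulTest_le χ
    exact ⟨C * ‖ℓ‖, abs_dual_mulTest_le hC ℓ⟩⟩
  map_add' _ _ := rfl
  map_smul' _ _ := rfl

theorem continuous_dualToHNegOneLoc : Continuous (dualToHNegOneLoc (N := N)) := by
  refine WithSeminorms.continuous_normedSpace_dom _ (withSeminorms_hNegOneLoc N) _ fun χ => ?_
  obtain ⟨C, hC⟩ := exists_h1Norm_mulTest_le χ
  refine ⟨C, fun ℓ => ?_⟩
  have : Nonempty {φ : Test N // h1Norm φ ≤ 1} := ⟨⟨0, by simp [h1Norm]⟩⟩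
  refine ciSup_le fun φ => (abs_dual_mulTest_le hC ℓ φ.1).trans ?_
  exact mul_le_of_le_one_right (by positivity) φ.2

/-! ### Approximation by functionals of finite rank -/

theorem Test.memLp_two (φ : Test N) : MemLp φ 2 volume :=
  φ.continuous.memLp_of_hasCompactSupport φ.hasCompactSupport

/-- The functional `φ ↦ ∫ g φ` on `H¹` given by a function `g ∈ L²`. -/
noncomputable def pairing (g : E N → ℝ) (hg : MemLp g 2 volume) : StrongDual ℝ (H1Test N) :=
  LinearMap.mkContinuous
    { toFun := fun φ => ∫ x, g x * toH1.symm φ x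
      map_add' := fun φ ψ => by
        refine Eq.trans ?_ (integral_add (hg.integrable_mul (Test.memLp_two _))
          (hg.integrable_mul (Test.memLp_two _)))
        simp [mul_add]
      map_smul' := fun c φ => by
        rw [RingHom.id_apply, smul_eq_mul, ← integral_const_mul]
        simp [mul_left_comm] }
    ((∫ x, ‖g x‖ ^ (2 : ℝ)) ^ (1 / 2 : ℝ)) fun φ => by
      obtain ⟨φ, rfl⟩ := toH1.surjective φ
      simp only [LinearMap.coe_mk, AddHom.coe_mk, LinearEquiv.symm_apply_apply]
      refine (norm_integral_le_integral_norm _).trans ?_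
      simp only [norm_mul]
      refine (integral_mul_norm_le_Lp_mul_Lq Real.HolderConjugate.two_two (by simpa using hg)
        (by simpa using φ.memLp_two)).trans ?_
      rw [norm_toH1]
      exact mul_le_mul_of_nonneg_left (l2Norm_le_h1Norm φ) (by positivity)

theorem pairing_toH1 (g : E N → ℝ) (hg : MemLp g 2 volume) (φ : Test N) :
    pairing g hg (toH1 φ) = ∫ x, g x * φ x := by
  simp [pairing]

theorem memLp_two_of_test {Ω : Opens (E N)} (f : 𝓓(Ω, ℝ)) : MemLp f 2 volume :=
  f.continuous.memLp_of_hasCompactSupport f.hasCompactSupport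

theorem dualToHNegOneLoc_pairing {Ω : Opens (E N)} (f : 𝓓(Ω, ℝ)) :
    dualToHNegOneLoc (pairing f (memLp_two_of_test f)) = toHNegOneLoc f := by
  refine Subtype.ext (DFunLike.ext _ _ fun φ => ?_)
  change pairing f (memLp_two_of_test f) (toH1 φ) = toDistribution f φ
  rw [pairing_toH1, toDistribution_apply]
  simp_rw [mul_comm]

/-- The functional `φ ↦ ⨍_Q φ` on `H¹`. -/
noncomputable def avgDual (hN : 1 ≤ N) (k : ℕ) (z : Fin N → ℤ) : StrongDual ℝ (H1Test N) :=
  pairing ((cube k z).indicator fun _ => (volume.real (cube (N := N) k z))⁻¹)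
    (memLp_indicator_const 2 (measurableSet_cube k z) _
      (.inr (by rw [volume_cube hN]; exact cubeVol_ne_top N k)))

theorem avgDual_toH1 (hN : 1 ≤ N) (k : ℕ) (z : Fin N → ℤ) (φ : Test N) :
    avgDual hN k z (toH1 φ) = ⨍ x in cube k z, φ x := by
  rw [avgDual, pairing_toH1, setAverage_eq, smul_eq_mul, ← integral_const_mul,
    ← integral_indicator (measurableSet_cube k z)]
  congr 1
  ext x
  by_cases hx : x ∈ cube k z <;> simp [hx]

theorem finite_cubeIndex_image {K : Set (E N)} (hK : Bornology.IsBounded K) (k : ℕ) :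
    (cubeIndex k '' K).Finite := by
  obtain ⟨R, hR⟩ := hK.exists_norm_le
  refine (Set.Finite.pi fun _ : Fin N =>
    finite_Icc ⌊-|R / side N k|⌋ ⌊|R / side N k|⌋).subset ?_
  rintro _ ⟨x, hx, rfl⟩ i -
  have h1 : |x i / side N k| ≤ |R / side N k| := by
    rw [abs_div, abs_div]
    refine div_le_div_of_nonneg_right ?_ (abs_nonneg _)
    exact (PiLp.norm_apply_le x i).trans ((hR x hx).trans (le_abs_self R))
  rw [abs_le] at h1
  exact ⟨Int.floor_le_floor h1.1, Int.floor_le_floor h1.2⟩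

/-- The integral of `f` against the cube averages of `φ` is a finite sum. -/
theorem integral_mul_cubeAvg {K : Set (E N)} {f : E N → ℝ} (hf : Integrable f)
    (hfK : ∀ x, x ∉ K → f x = 0) (φ : E N → ℝ) {k : ℕ} {Z : Finset (Fin N → ℤ)}
    (hZ : ∀ x ∈ K, cubeIndex k x ∈ Z) :
    Integrable (fun x => f x * cubeAvg φ k x) ∧ ∫ x, f x * cubeAvg φ k x =
      ∑ z ∈ Z, (∫ x in cube k z, f x) * ⨍ x in cube k z, φ x := by
  have hcongr : ∀ z, EqOn (fun x => f x * cubeAvg φ k x)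
      (fun x => f x * ⨍ y in cube k z, φ y) (cube k z) := fun z x hx => by
    simp only [cubeAvg, mem_cube.1 hx]
  have hint : ∀ z, IntegrableOn (fun x => f x * cubeAvg φ k x) (cube k z) := fun z =>
    IntegrableOn.congr_fun (hf.integrableOn.mul_const _) (hcongr z).symm (measurableSet_cube k z)
  have hzero : ∀ x, x ∉ ⋃ z ∈ Z, cube (N := N) k z → f x * cubeAvg φ k x = 0 := by
    intro x hx
    rw [hfK x fun hxK => hx (mem_iUnion₂.2 ⟨_, hZ x hxK, rfl⟩), zero_mul]
  have hU : IntegrableOn (fun x => f x * cubeAvg φ k x) (⋃ z ∈ Z, cube (N := N) k z) :=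
    integrableOn_finset_iUnion.2 fun z _ => hint z
  refine ⟨integrableOn_univ.1
    (hU.of_forall_sdiff_eq_zero MeasurableSet.univ fun x hx => hzero x hx.2), ?_⟩
  rw [← setIntegral_eq_integral_of_forall_compl_eq_zero hzero,
    integral_biUnion_finset Z (fun z _ => measurableSet_cube k z) ?_ fun z _ => hint z]
  · refine Finset.sum_congr rfl fun z _ => ?_
    rw [setIntegral_congr_fun (measurableSet_cube k z) (hcongr z), integral_mul_const]
  · intro z _ w _ hzw
    exact disjoint_left.2 fun x hx hx' => hzw (hx.symm.trans hx')

theorem lintegral_fderiv_sq_le (φ : Test N) :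
    (∫⁻ x, ‖fderiv ℝ φ x‖ₑ ^ 2) ^ (1 / 2 : ℝ) ≤ ENNReal.ofReal (h1Norm φ) := by
  have h : ∫⁻ x, ‖fderiv ℝ φ x‖ₑ ^ 2 ≤
      ENNReal.ofReal (∫ x, (φ x ^ 2 + ‖fderiv ℝ φ x‖ ^ 2)) := by
    rw [ofReal_integral_eq_lintegral_ofReal (integrable_h1Norm φ)
      (.of_forall fun x => by positivity)]
    refine lintegral_mono fun x => ?_
    rw [← ofReal_norm, ← ENNReal.ofReal_pow (norm_nonneg _)]
    exact ENNReal.ofReal_le_ofReal (le_add_of_nonneg_left (sq_nonneg _))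
  rw [h1Norm, Real.sqrt_eq_rpow, ← ENNReal.ofReal_rpow_of_nonneg
    (integral_nonneg fun x => by positivity) (by norm_num)]
  exact ENNReal.rpow_le_rpow h (by norm_num)

/-- In `H⁻¹`, `f` is close to the finite rank functional obtained by replacing `φ` by its averages
over the cubes of generation `k`, uniformly when the tail of the energy is uniformly small. -/
theorem norm_pairing_sub_le (hN : 1 ≤ N) {Ω : Opens (E N)} (f : 𝓓(Ω, ℝ)) {K : Set (E N)}
    (hfK : tsupport f ⊆ K) {k : ℕ} {Z : Finset (Fin N → ℤ)} (hZ : ∀ x ∈ K, cubeIndex k x ∈ Z)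
    {ε : ℝ≥0}
    (hε : 4 ^ N * (4 * ∑' j, ENNReal.ofReal (rad (k + j)) ^ 2 * (cubeVol N (k + j))⁻¹ *
          cubeEnergy (fun x => ‖f x‖ₑ) (k + j)) ^ (1 / 2 : ℝ) ≤ ε) :
    ‖pairing f (memLp_two_of_test f) - ∑ z ∈ Z, (∫ x in cube k z, f x) • avgDual hN k z‖ ≤ ε := by
  refine ContinuousLinearMap.opNorm_le_bound _ ε.coe_nonneg fun φ => ?_
  obtain ⟨φ, rfl⟩ := toH1.surjective φ
  have hf : Integrable f volume := f.continuous.integrable_of_hasCompactSupport f.hasCompactSupport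
  obtain ⟨hint, hsum⟩ := integral_mul_cubeAvg hf (fun x hx => image_eq_zero_of_notMem_tsupport
    fun h => hx (hfK h)) φ hZ
  have hval : (pairing f (memLp_two_of_test f) -
      ∑ z ∈ Z, (∫ x in cube k z, f x) • avgDual hN k z) (toH1 φ) =
      ∫ x, f x * (φ x - cubeAvg φ k x) := by
    simp only [mul_sub]
    refine Eq.trans ?_
      (integral_sub ((memLp_two_of_test f).integrable_mul φ.memLp_two) hint).symm
    rw [hsum]
    simp [pairing_toH1, avgDual_toH1]
  rw [hval, norm_toH1, ← ENNReal.ofReal_le_ofReal_iff (mul_nonneg ε.coe_nonneg (h1Norm_nonneg φ)),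
    ofReal_norm, ENNReal.ofReal_mul ε.coe_nonneg]
  calc ‖∫ x, f x * (φ x - cubeAvg φ k x)‖ₑ
      ≤ ∫⁻ x, ‖f x‖ₑ * ‖φ x - cubeAvg φ k x‖ₑ := by
        refine (enorm_integral_le_lintegral_enorm _).trans (le_of_eq ?_)
        simp only [enorm_mul]
    _ ≤ _ := lintegral_mul_sub_cubeAvg_le hN f.continuous.enorm.measurable φ.contDiff_one
        φ.hasCompactSupport k
    _ ≤ 4 ^ N * (ENNReal.ofReal (h1Norm φ) *
        (4 * ∑' j, ENNReal.ofReal (rad (k + j)) ^ 2 * (cubeVol N (k + j))⁻¹ *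
          cubeEnergy (fun x => ‖f x‖ₑ) (k + j)) ^ (1 / 2 : ℝ)) := by
        gcongr
        exact lintegral_fderiv_sq_le φ
    _ ≤ _ := by
        rw [mul_left_comm, mul_comm, ENNReal.ofReal_coe_nnreal]
        gcongr

/-- A set that is approximated at every precision by totally bounded sets is totally bounded. -/
theorem totallyBounded_of_forall_approx {X : Type*} [PseudoMetricSpace X] {S : Set X}
    (h : ∀ ε > 0, ∃ T : Set X, TotallyBounded T ∧ ∀ x ∈ S, ∃ y ∈ T, dist x y ≤ ε) :
    TotallyBounded S := by
  rw [Metric.totallyBounded_iff]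
  intro ε hε
  obtain ⟨T, hT, hST⟩ := h (ε / 2) (half_pos hε)
  obtain ⟨t, ht, hTt⟩ := Metric.totallyBounded_iff.1 hT (ε / 2) (half_pos hε)
  refine ⟨t, ht, fun x hx => ?_⟩
  obtain ⟨y, hy, hxy⟩ := hST x hx
  obtain ⟨c, hc, hyc⟩ := mem_iUnion₂.1 (hTt hy)
  rw [Metric.mem_ball] at hyc
  refine mem_iUnion₂.2 ⟨c, hc, ?_⟩
  rw [Metric.mem_ball]
  linarith [dist_triangle x y c]

theorem abs_setIntegral_cube_le {f : E N → ℝ} {k : ℕ} {A : ℝ≥0}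
    (hA : cubeEnergy (fun x => ‖f x‖ₑ) k ≤ A ^ 2) (z : Fin N → ℤ) :
    |∫ x in cube k z, f x| ≤ A := by
  have h1 := ((ENNReal.le_tsum z).trans hA : (∫⁻ x in cube k z, ‖f x‖ₑ) ^ 2 ≤ (A : ℝ≥0∞) ^ 2)
  have h2 := (ENNReal.pow_le_pow_left_iff two_ne_zero).1 h1
  have h3 := (enorm_integral_le_lintegral_enorm (μ := volume.restrict (cube k z)) f).trans h2
  rw [← ofReal_norm, ← ENNReal.ofReal_coe_nnreal,
    ENNReal.ofReal_le_ofReal_iff A.coe_nonneg] at h3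
  exact h3

/-- The tails of the energy bound are arbitrarily small; this is where the condition on `p` and `α`
enters. -/
theorem exists_energy_tail_le (hN : 1 ≤ N) {p α : ℝ} (hp : 1 ≤ p)
    (h : 2 * (N : ℝ) / (N + 2) < p ∨ (p = 2 * (N : ℝ) / (N + 2) ∧ 1 / 2 < α))
    {D : ℝ≥0∞} (hD : D ≠ ∞) {ε : ℝ≥0} (hε : 0 < ε) (m : ℕ) :
    ∃ k ≥ m, 4 ^ N * (4 * (D * ∑' j, ENNReal.ofReal (decay N p α (k + j)))) ^ (1 / 2 : ℝ) ≤
      (ε : ℝ≥0∞) := by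
  have hnonneg : ∀ k, 0 ≤ decay N p α k := fun k => by
    have := side_pos hN k
    have := rad_pos k
    unfold decay; positivity
  have hsum : ∑' j, ENNReal.ofReal (decay N p α j) ≠ ∞ :=
    (summable_decay hN hp h).tsum_ofReal_ne_top
  have htail := ENNReal.tendsto_sum_nat_add _ hsum
  have hlim : Filter.Tendsto (fun k => (4 : ℝ≥0∞) ^ N *
      (4 * (D * ∑' j, ENNReal.ofReal (decay N p α (j + k)))) ^ (1 / 2 : ℝ))
      Filter.atTop (nhds (4 ^ N * (4 * (D * 0)) ^ (1 / 2 : ℝ))) := by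
    refine ENNReal.Tendsto.const_mul ?_ (.inr (by simp))
    refine (ENNReal.continuous_rpow_const.tendsto _).comp ?_
    exact ENNReal.Tendsto.const_mul (ENNReal.Tendsto.const_mul htail (.inr hD)) (.inr (by simp))
  have h0 : (4 : ℝ≥0∞) ^ N * (4 * (D * 0)) ^ (1 / 2 : ℝ) = 0 := by
    simp
  rw [h0] at hlim
  obtain ⟨k, hk, hkm⟩ := ((hlim.eventually_le_const (ENNReal.coe_pos.2 hε)).and
    (Filter.eventually_ge_atTop m)).exists
  exact ⟨k, hkm, by simpa only [add_comm] using hk⟩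

end VSpace

open VSpace in
theorem theorem3p1 {N : ℕ} (hN : 1 ≤ N) (Ω : TopologicalSpace.Opens (VSpace.E N))
    (hΩ : Bornology.IsBounded (Ω : Set (VSpace.E N)))
    (p α R₀ : ℝ) (hp : 1 ≤ p) (hp2 : p ≤ 2) (hR₀ : 0 < R₀) (hR₀' : R₀ < 1 / 2)
    {ι : Type*} (f : ι → 𝓓(Ω, ℝ))
    (K : Set (VSpace.E N)) (hK : IsCompact K) (hKΩ : K ⊆ Ω) (hfK : ∀ i, tsupport (f i) ⊆ K)
    (C : ℝ≥0) (hfC : ∀ i, VSpace.vNorm p 2 α R₀ Ω (f i) ≤ C)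
    (h : 2 * (N : ℝ) / (N + 2) < p ∨ (p = 2 * (N : ℝ) / (N + 2) ∧ 1 / 2 < α)) :
    IsCompact (closure (Set.range fun i => VSpace.toHNegOneLoc (f i))) := by
  -- From generation `m` on, the balls around cubes that meet `K` are admissible.
  obtain ⟨δ, hδ, hδΩ⟩ := hK.exists_thickening_subset_open Ω.isOpen hKΩ
  obtain ⟨m, hm⟩ := exists_pow_lt_of_lt_one (lt_min hR₀ (half_pos hδ))
    (by norm_num : (2⁻¹ : ℝ) < 1)
  have hrad : ∀ k ≥ m, rad k ≤ min R₀ (δ / 2) := fun k hk =>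
    (pow_le_pow_of_le_one (by norm_num) (by norm_num) hk).trans hm.le
  -- The weight degenerates at radius one, which `R₀ < 1/2` excludes.
  have hm0 : m ≠ 0 := by
    rintro rfl
    have := (lt_min_iff.1 hm).1
    norm_num at this
    linarith
  have hR : ∀ k ≥ m, rad k ≤ R₀ := fun k hk => (hrad k hk).trans (min_le_left _ _)
  have hB : ∀ k ≥ m, ∀ x ∈ K, Metric.ball x (2 * rad k) ⊆ Ω := fun k hk x hx => by
    refine Subset.trans ?_ ((Metric.ball_subset_thickening hx δ).trans hδΩ)
    exact Metric.ball_subset_ball (by linarith [(hrad k hk).trans (min_le_right _ _)])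
  set D : ℝ≥0∞ := (4 * N) ^ N * C ^ 2 * volume (Metric.ball (0 : E N) 1) ^ 2
  have hD : D ≠ ∞ := by
    have : volume (Metric.ball (0 : E N) 1) ≠ ∞ := measure_ball_lt_top.ne
    finiteness
  set S : Set (StrongDual ℝ (H1Test N)) :=
    range fun i => pairing (f i) (memLp_two_of_test (f i))
  have hS : TotallyBounded S := by
    refine totallyBounded_of_forall_approx fun ε hε => ?_
    lift ε to ℝ≥0 using hε.le
    obtain ⟨k, hkm, hk⟩ := exists_energy_tail_le hN hp h hD (ε := ε) (by exact_mod_cast hε) m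
    have hfin := finite_cubeIndex_image hK.isBounded k
    set Z := hfin.toFinset
    have hZ : ∀ x ∈ K, cubeIndex k x ∈ Z := fun x hx => hfin.mem_toFinset.2 ⟨x, hx, rfl⟩
    obtain ⟨A, hA⟩ : ∃ A : ℝ≥0, ∀ i, cubeEnergy (fun x => ‖f i x‖ₑ) k ≤ (A : ℝ≥0∞) ^ 2 := by
      have hfinite : (4 * N) ^ N * (C : ℝ≥0∞) ^ 2 * (volume (Metric.ball (0 : E N) (rad k)) /
          ENNReal.ofReal (ballWeight N p α k)) ^ 2 ≠ ∞ := by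
        have h1 : volume (Metric.ball (0 : E N) (rad k)) ≠ ∞ := measure_ball_lt_top.ne
        have h2 : ENNReal.ofReal (ballWeight N p α k) ≠ 0 := by
          simpa [ENNReal.ofReal_eq_zero, not_le] using ballWeight_pos N p α (by omega : k ≠ 0)
        have := ENNReal.div_ne_top h1 h2
        finiteness
      lift ((4 * N) ^ N * (C : ℝ≥0∞) ^ 2 * (volume (Metric.ball (0 : E N) (rad k)) /
          ENNReal.ofReal (ballWeight N p α k)) ^ 2) to ℝ≥0 using hfinite with B hBeq
      refine ⟨NNReal.sqrt B, fun i => ?_⟩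
      rw [← ENNReal.coe_pow, NNReal.sq_sqrt, hBeq]
      exact cubeEnergy_le hN (hfC i) (hfK i) (by omega) (hR k hkm) (hB k hkm)
    -- The coefficients `∫_Q f` are bounded uniformly, and only finitely many cubes meet `K`.
    refine ⟨(fun c : Z → ℝ => ∑ z : Z, c z • avgDual hN k z.1) '' Metric.closedBall 0 A,
      ((isCompact_closedBall _ _).image (by fun_prop)).totallyBounded, ?_⟩
    rintro _ ⟨i, rfl⟩
    refine ⟨_, ⟨fun z => ∫ x in cube k z.1, f i x, ?_, rfl⟩, ?_⟩
    · rw [mem_closedBall_zero_iff, pi_norm_le_iff_of_nonneg A.coe_nonneg]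
      exact fun z => abs_setIntegral_cube_le (hA i) z.1
    · rw [dist_eq_norm]
      simp only
      rw [Finset.sum_coe_sort Z fun z => (∫ x in cube k z, f i x) • avgDual hN k z]
      refine norm_pairing_sub_le hN (f i) (hfK i) hZ (le_trans ?_ hk)
      rw [← ENNReal.tsum_mul_left (a := D)]
      gcongr 4 ^ N * (4 * ?_) ^ (1 / 2 : ℝ)
      refine ENNReal.tsum_le_tsum fun j => ?_
      exact rad_sq_mul_cubeEnergy_le hN (hfC i) (hfK i) (by omega) (hR _ (by omega))
        (hB _ (by omega))
  -- `H⁻¹` is complete, and it maps continuously into `H⁻¹_loc`, a regular space.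
  have hcomp : IsCompact (closure S) :=
    hS.closure.isCompact_of_isClosed isClosed_closure
  have : IsTopologicalAddGroup (HNegOneLoc N) := (withSeminorms_hNegOneLoc N).topologicalAddGroup
  refine (hcomp.image continuous_dualToHNegOneLoc).closure_of_subset ?_
  rintro _ ⟨i, rfl⟩
  exact ⟨_, subset_closure ⟨i, rfl⟩, dualToHNegOneLoc_pairing (f i)⟩
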